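/- Let $d,k\ge 1$, let $A\in\mathbb R^{d\times d}$ be positive semidefinite, let $B(0,1)$ be the closed Euclidean unit ball of $\mathbb R^d$, and let $f:\mathbb R^d\to\mathbb R\cup\{\infty\}$ be symmetric (invariant under permutations of the coordinates) and convex. For a symmetric matrix $M$ let $\lambda(M)$ be its vector of eigenvalues in non-decreasing order. Consider the spectral design problem $$\min\bigl\{f\bigl(\lambda(A+XX^{\top})\bigr)\;:\;X=[x^1,\dots,x^k],\ x^1,\dots,x^k\in B(0,1)\bigr\}.\qquad(\ast)$$ **The algorithm.** Let $\hat d=\min\{d,k\}$. 1. Compute an eigendecomposition $A=Q\,\mathrm{diag}(t_1,\dots,t_d)\,Q^{\top}$ with $Q$ orthogonal and $t_1\le\dots\le t_d$. 2. Put $u_j=t_{j+\hat d}$ for $j\le d-\hat d$ and $u_j=\infty$ for $j>d-\hat d$. 3. For $s\in[0,k]$ put $c(s)=\inf\{c\ge t_1:\sum_j\min\{(c-t_j)_+,u_j-t_j\}\ge s\}$ and $\beta_j(s)=\min\{(c(s)-t_j)_+,u_j-t_j\}$. 4. If $f$ is declared to be non-increasing, let $s^*=k$; otherwise let $s^*$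 be an $\varepsilon$-optimal solution of $\min_{0\le s\le k}f(t+\beta(s))$. 5. Let $\beta'_j=(c(s^*)-t_j)_+$ for $j\le\hat d$ and $\beta'_j=0$ for $j>\hat d$. 6. Compute $Z\in\mathbb R^{d\times k}$ with $ZZ^{\top}=\mathrm{diag}(\beta')$ whose columns all have squared length $\frac1k\sum_j\beta'_j$. 7. Return $X^*=QZ$. **Cost model.** Running time is counted on a real random access machine (unit-cost real arithmetic, square roots, comparisons and memory access, and additive index arithmetic) that has a subroutine for exact eigendecompositions of symmetric $n\times n$ matrices, charged $O(n^3)$, and a value oracle for $f$, charged $O(d)$ time per call. The input consists of $d$, $k$, $A$, the declaration whether $f$ is treated as non-increasing, and, for the second statement, $L$ and $\varepsilon$. Write $\log^+x=\max\{0,\log x\}$. **Theorem.** Every design that the algorithm can return (for any valid choices in steps 1, 4 and 6) is optimal for $(\ast)$ in the setting of 1 and $\varepsilon$-optimal for $(\ast)$ in the setting of 2. Moreover there is one program on this machine, with an absolute constant in all the bounds below, that implements the algorithm in the following sense. 1. If $f$ is non-increasing in each coordinate and is declared so, the program returns an output of the algorithm, which is an optimal solution of $(\ast)$, in time $O(d^3+kd)$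 and without any oracle call. For given $A$ and $k$, the returned design is the same for every such $f$. 2. If $f$ is finite and Lipschitz continuous (in the Euclidean norm) with constant $L>0$ on the eigenvalue region $\{\lambda(A+XX^{\top}):x^1,\dots,x^k\in B(0,1)\}$, then for every $\varepsilon>0$ (with $f$ declared non-increasing only if it is), the program returns an output of the algorithm, which is an $\varepsilon$-optimal solution of $(\ast)$, with $O(\log^+(kL/\varepsilon))$ oracle calls and in time $O(d^3+kd+d\log^+(kL/\varepsilon))$. -/

import Mathlib

namespace SpectralDesign

/-! ### The spectral design problem -/

/-- The eigenvalues of a symmetric matrix, with multiplicity, in non-decreasing order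
(a junk value is returned for non-symmetric matrices, which never occur below). -/
noncomputable def sortedEigs {d : ℕ} (M : Matrix (Fin d) (Fin d) ℝ) : Fin d → ℝ :=
  open Classical in
  if h : M.IsHermitian then
    fun i => h.eigenvalues₀ (Fin.cast (Fintype.card_fin d).symm i.rev)
  else 0

/-- `f : ℝᵈ → ℝ ∪ {∞}` is symmetric and convex. -/
structure IsSymmConvex {d : ℕ} (f : (Fin d → ℝ) → EReal) : Prop where
  ne_bot : ∀ x, f x ≠ ⊥
  symm : ∀ (σ : Equiv.Perm (Fin d)) (x : Fin d → ℝ), f (x ∘ σ) = f x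
  convex : ∀ (x y : Fin d → ℝ) (a b : ℝ), 0 < a → 0 < b → a + b = 1 →
    f (a • x + b • y) ≤ (a : EReal) * f x + (b : EReal) * f y

/-- The columns of `X` are `k` design vectors in the closed Euclidean unit ball. -/
def Feasible {d k : ℕ} (X : Matrix (Fin d) (Fin k) ℝ) : Prop :=
  ∀ j, ∑ i, X i j ^ 2 ≤ 1

/-- The eigenvalue vector of the updated information matrix `A + X Xᵀ`. -/
noncomputable def infoEigs {d k : ℕ} (A : Matrix (Fin d) (Fin d) ℝ)
    (X : Matrix (Fin d) (Fin k) ℝ) : Fin d → ℝ :=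
  sortedEigs (A + X * X.transpose)

/-- `X` is an optimal design for the objective `f` and the prior `A`. -/
def IsOptimal {d k : ℕ} (A : Matrix (Fin d) (Fin d) ℝ) (f : (Fin d → ℝ) → EReal)
    (X : Matrix (Fin d) (Fin k) ℝ) : Prop :=
  Feasible X ∧
    ∀ Y : Matrix (Fin d) (Fin k) ℝ, Feasible Y → f (infoEigs A X) ≤ f (infoEigs A Y)

/-- `X` is an `ε`-optimal design for the objective `f` and the prior `A`. -/
def IsEpsOptimal {d k : ℕ} (A : Matrix (Fin d) (Fin d) ℝ) (f : (Fin d → ℝ) → EReal)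
    (ε : ℝ) (X : Matrix (Fin d) (Fin k) ℝ) : Prop :=
  Feasible X ∧
    ∀ Y : Matrix (Fin d) (Fin k) ℝ, Feasible Y →
      f (infoEigs A X) ≤ f (infoEigs A Y) + (ε : EReal)

/-- The region `{λ(A + X Xᵀ) : x¹, …, xᵏ ∈ B(0,1)}`. -/
def eigRegion {d : ℕ} (A : Matrix (Fin d) (Fin d) ℝ) (k : ℕ) : Set (Fin d → ℝ) :=
  {l | ∃ X : Matrix (Fin d) (Fin k) ℝ, Feasible X ∧ l = infoEigs A X}

/-- `f` is finite and Lipschitz with constant `L`, for the Euclidean norm, on `S`. -/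
def LipschitzOnRegion {d : ℕ} (f : (Fin d → ℝ) → EReal) (L : ℝ) (S : Set (Fin d → ℝ)) : Prop :=
  (∀ x ∈ S, f x ≠ ⊤) ∧
    ∀ x ∈ S, ∀ y ∈ S, |(f x).toReal - (f y).toReal| ≤ L * ‖WithLp.toLp 2 (x - y)‖

/-! ### The steps of the spectral design algorithm -/

/-- `A = Q diag(t) Qᵀ` with `Q` orthogonal and `t` non-decreasing. -/
structure IsEigendecomp {n : ℕ} (S Q : Matrix (Fin n) (Fin n) ℝ) (t : Fin n → ℝ) : Prop where
  orthogonal : Q.transpose * Q = 1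
  sorted : Monotone t
  eq : S = Q * Matrix.diagonal t * Q.transpose

/-- The amount of water in bucket `j` at water level `c`: `min {(c - t_j)₊, u_j - t_j}`, where
the capacity `u_j` is `t_{j + min {d, k}}` if that index exists, and infinite otherwise. -/
noncomputable def fill {d : ℕ} (t : Fin d → ℝ) (k : ℕ) (c : ℝ) (j : Fin d) : ℝ :=
  if h : (j : ℕ) + min d k < d then
    min (max (c - t j) 0) (t ⟨(j : ℕ) + min d k, h⟩ - t j)
  else max (c - t j) 0

/-- The water level `c(s) = inf {c ≥ t₁ : Φ_k(c) ≥ s}` after pouring `s` units of water. -/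
noncomputable def level {d : ℕ} [NeZero d] (t : Fin d → ℝ) (k : ℕ) (s : ℝ) : ℝ :=
  sInf {c | t 0 ≤ c ∧ s ≤ ∑ j, fill t k c j}

/-- The water-filling vector `β(s)`. -/
noncomputable def beta {d : ℕ} [NeZero d] (t : Fin d → ℝ) (k : ℕ) (s : ℝ) : Fin d → ℝ :=
  fill t k (level t k s)

/-- The rearranged vector `β'(s)`, supported on the first `min {d, k}` coordinates. -/
noncomputable def beta' {d : ℕ} [NeZero d] (t : Fin d → ℝ) (k : ℕ) (s : ℝ) : Fin d → ℝ :=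
  fun j => if (j : ℕ) < min d k then max (level t k s - t j) 0 else 0

/-- The choice of the budget: `s = k` when `f` is declared to be non-increasing, and otherwise an
`ε`-optimal solution of `min {f(t + β(s)) : 0 ≤ s ≤ k}`. -/
def IsBudget {d : ℕ} [NeZero d] (t : Fin d → ℝ) (k : ℕ) (mono : Bool)
    (f : (Fin d → ℝ) → EReal) (ε s : ℝ) : Prop :=
  if mono then s = k
  else s ∈ Set.Icc (0 : ℝ) k ∧
    ∀ s' ∈ Set.Icc (0 : ℝ) k, f (t + beta t k s) ≤ f (t + beta t k s') + (ε : EReal)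

/-- `X` is a possible result of the spectral design algorithm: an eigendecomposition
`A = Q diag(t) Qᵀ`, a budget `s`, and a Schur--Horn factorization `Z Zᵀ = diag(β'(s))` in which
all `k` columns have the same squared length `Tr(diag(β'(s))) / k` are computed, and `X = Q Z`
is returned. -/
def IsAlgorithmOutput {d k : ℕ} [NeZero d] (A : Matrix (Fin d) (Fin d) ℝ) (mono : Bool)
    (f : (Fin d → ℝ) → EReal) (ε : ℝ) (X : Matrix (Fin d) (Fin k) ℝ) : Prop :=
  ∃ (Q : Matrix (Fin d) (Fin d) ℝ) (t : Fin d → ℝ) (s : ℝ) (Z : Matrix (Fin d) (Fin k) ℝ),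
    IsEigendecomp A Q t ∧ IsBudget t k mono f ε s ∧
    Z * Z.transpose = Matrix.diagonal (beta' t k s) ∧
    (∀ i, (Z.transpose * Z) i i = (∑ j, beta' t k s j) / k) ∧
    X = Q * Z

/-! ### The machine model

A real random access machine with a subroutine for symmetric eigendecompositions, charged
cubically, and with access to a value oracle for the objective. -/

/-- An exact eigensolver for real symmetric matrices. -/
structure Eigensolver where
  vecs : ∀ n : ℕ, Matrix (Fin n) (Fin n) ℝ → Matrix (Fin n) (Fin n) ℝ
  vals : ∀ n : ℕ, Matrix (Fin n) (Fin n) ℝ → Fin n → ℝ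
  spec : ∀ (n : ℕ) (S : Matrix (Fin n) (Fin n) ℝ), S.IsSymm →
    IsEigendecomp S (vecs n S) (vals n S)

/-- The memory: registers for natural numbers, registers for reals, and two-dimensional arrays
of reals (the last two arguments of `arr` are the row and the column). -/
structure Memory where
  nat : ℕ → ℕ
  real : ℕ → ℝ
  arr : ℕ → ℕ → ℕ → ℝ

inductive NatOp
  | add | sub

def NatOp.eval : NatOp → ℕ → ℕ → ℕ
  | .add, a, b => a + b
  | .sub, a, b => a - b

inductive RealOp
  | add | sub | mul | div

noncomputable def RealOp.eval : RealOp → ℝ → ℝ → ℝ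
  | .add, a, b => a + b
  | .sub, a, b => a - b
  | .mul, a, b => a * b
  | .div, a, b => a / b

/-- The basic instructions; all arguments of type `ℕ` are the numbers of registers or arrays,
except for the constant `c` in `setNat`. -/
inductive Instr
  /-- `nat i := c` -/
  | setNat (i c : ℕ)
  /-- `nat i := nat j ∘ nat l` -/
  | natOp (o : NatOp) (i j l : ℕ)
  /-- `real i := nat j` -/
  | ofNat (i j : ℕ)
  /-- `real i := real j ∘ real l` -/
  | realOp (o : RealOp) (i j l : ℕ)
  /-- `real i := √(real j)` -/
  | sqrt (i j : ℕ)
  /-- `real i := arr a [nat r, nat c]` -/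
  | load (i a r c : ℕ)
  /-- `arr a [nat r, nat c] := real i` -/
  | store (a r c i : ℕ)
  /-- eigendecomposition of the leading `n × n` block of array `a`, where `n := nat m`; the
  orthogonal factor goes to the leading block of array `q`, the eigenvalues to row `0` of `t` -/
  | eig (m a q t : ℕ)
  /-- value of the objective at the first `d` entries of row `0` of array `a`: if it is finite,
  it goes to `real v` and `nat g := 1`, and if it is infinite, `real v := 0` and `nat g := 0` -/
  | query (a v g : ℕ)

/-- Overwrites one entry of one array. -/
def Memory.setEntry (M : Memory) (a r c : ℕ) (x : ℝ) : Memory :=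
  { M with arr := fun a' r' c' => if a' = a ∧ r' = r ∧ c' = c then x else M.arr a' r' c' }

/-- Overwrites the leading `m × n` block of one array. -/
def Memory.setBlock (M : Memory) (a : ℕ) {m n : ℕ} (B : Matrix (Fin m) (Fin n) ℝ) : Memory :=
  { M with arr := fun a' r c =>
      if h : a' = a ∧ r < m ∧ c < n then B ⟨r, h.2.1⟩ ⟨c, h.2.2⟩ else M.arr a' r c }

/-- The leading `m × n` block of one array. -/
def Memory.block (M : Memory) (a m n : ℕ) : Matrix (Fin m) (Fin n) ℝ :=
  Matrix.of fun i j => M.arr a i j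

open Classical in
/-- The effect of a basic instruction. -/
noncomputable def Instr.effect (E : Eigensolver) {d : ℕ} (f : (Fin d → ℝ) → EReal) :
    Instr → Memory → Memory
  | .setNat i c, M => { M with nat := Function.update M.nat i c }
  | .natOp o i j l, M =>
      { M with nat := Function.update M.nat i (o.eval (M.nat j) (M.nat l)) }
  | .ofNat i j, M => { M with real := Function.update M.real i (M.nat j) }
  | .realOp o i j l, M =>
      { M with real := Function.update M.real i (o.eval (M.real j) (M.real l)) }
  | .sqrt i j, M => { M with real := Function.update M.real i (Real.sqrt (M.real j)) }
  | .load i a r c, M =>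
      { M with real := Function.update M.real i (M.arr a (M.nat r) (M.nat c)) }
  | .store a r c i, M => M.setEntry a (M.nat r) (M.nat c) (M.real i)
  | .eig m a q t, M =>
      let S := M.block a (M.nat m) (M.nat m)
      (M.setBlock q (E.vecs _ S)).setBlock t (Matrix.of fun _ : Fin 1 => E.vals _ S)
  | .query a v g, M =>
      let y := f fun j : Fin d => M.arr a 0 j
      { M with
        real := Function.update M.real v y.toReal
        nat := Function.update M.nat g (if y = ⊤ then 0 else 1) }

/-- The running time of a basic instruction: an `n × n` eigendecomposition is charged `n ^ 3 + 1`,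
an oracle call at a point of `ℝᵈ` is charged `d + 1`, and everything else is charged `1`. -/
def Instr.time (d : ℕ) : Instr → Memory → ℕ
  | .eig m _ _ _, M => M.nat m ^ 3 + 1
  | .query _ _ _, _ => d + 1
  | _, _ => 1

/-- The number of oracle calls of a basic instruction. -/
def Instr.calls : Instr → ℕ
  | .query _ _ _ => 1
  | _ => 0

/-- The tests `nat i < nat j` and `real i ≤ real j`. -/
inductive Test
  | natLt (i j : ℕ)
  | realLe (i j : ℕ)

def Test.Holds : Test → Memory → Prop
  | .natLt i j, M => M.nat i < M.nat j
  | .realLe i j, M => M.real i ≤ M.real j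

/-- Programs. -/
inductive Program
  | instr (I : Instr)
  | seq (p q : Program)
  | ite (b : Test) (p q : Program)
  | while (b : Test) (p : Program)

/-- `Exec E f p M M' T N`: with the eigensolver `E` and the value oracle `f`, the program `p`
started in memory `M` halts in memory `M'` after time `T` and `N` oracle calls. -/
inductive Exec (E : Eigensolver) {d : ℕ} (f : (Fin d → ℝ) → EReal) :
    Program → Memory → Memory → ℕ → ℕ → Prop
  | instr (I : Instr) (M : Memory) :
      Exec E f (.instr I) M (I.effect E f M) (I.time d M) I.calls
  | seq {p q : Program} {M₀ M₁ M₂ : Memory} {T₁ T₂ N₁ N₂ : ℕ} :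
      Exec E f p M₀ M₁ T₁ N₁ → Exec E f q M₁ M₂ T₂ N₂ →
      Exec E f (.seq p q) M₀ M₂ (T₁ + T₂) (N₁ + N₂)
  | iteTrue {b : Test} {p q : Program} {M M' : Memory} {T N : ℕ} :
      b.Holds M → Exec E f p M M' T N → Exec E f (.ite b p q) M M' (T + 1) N
  | iteFalse {b : Test} {p q : Program} {M M' : Memory} {T N : ℕ} :
      ¬ b.Holds M → Exec E f q M M' T N → Exec E f (.ite b p q) M M' (T + 1) N
  | whileDone {b : Test} {p : Program} {M : Memory} :
      ¬ b.Holds M → Exec E f (.while b p) M M 1 0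
  | whileStep {b : Test} {p : Program} {M₀ M₁ M₂ : Memory} {T₁ T₂ N₁ N₂ : ℕ} :
      b.Holds M₀ → Exec E f p M₀ M₁ T₁ N₁ → Exec E f (.while b p) M₁ M₂ T₂ N₂ →
      Exec E f (.while b p) M₀ M₂ (T₁ + T₂ + 1) (N₁ + N₂)

/-- The initial memory: the sizes `d`, `k` and the declaration `mono` that the objective is
non-increasing are in the first three registers for natural numbers, `L` and `ε` are in the first
two registers for reals, and `A` is in array `0`. -/
noncomputable def inputMemory {d : ℕ} (k : ℕ) (A : Matrix (Fin d) (Fin d) ℝ) (mono : Bool)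
    (L ε : ℝ) : Memory where
  nat i := if i = 0 then d else if i = 1 then k else if i = 2 then mono.toNat else 0
  real i := if i = 0 then L else if i = 1 then ε else 0
  arr a i j := if h : a = 0 ∧ i < d ∧ j < d then A ⟨i, h.2.1⟩ ⟨j, h.2.2⟩ else 0

/-- On the given input, `p` halts after time `T` and `N` oracle calls with the `d × k` matrix `X`
in array `1`. -/
def Returns (E : Eigensolver) {d k : ℕ} (p : Program) (A : Matrix (Fin d) (Fin d) ℝ) (mono : Bool)
    (f : (Fin d → ℝ) → EReal) (L ε : ℝ) (X : Matrix (Fin d) (Fin k) ℝ) (T N : ℕ) : Prop :=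
  ∃ M : Memory, Exec E f p (inputMemory k A mono L ε) M T N ∧ M.block 1 d k = X

/-- The machine is deterministic. -/
theorem Exec.deterministic {E : Eigensolver} {d : ℕ} {f : (Fin d → ℝ) → EReal} {p : Program}
    {M M₁ M₂ : Memory} {T₁ T₂ N₁ N₂ : ℕ} (h₁ : Exec E f p M M₁ T₁ N₁)
    (h₂ : Exec E f p M M₂ T₂ N₂) : M₁ = M₂ ∧ T₁ = T₂ ∧ N₁ = N₂ := by
  induction h₁ generalizing M₂ T₂ N₂ with
  | instr I M => cases h₂; exact ⟨rfl, rfl, rfl⟩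
  | seq _ _ ih₁ ih₂ =>
    cases h₂ with
    | seq a b =>
      obtain ⟨rfl, rfl, rfl⟩ := ih₁ a
      obtain ⟨rfl, rfl, rfl⟩ := ih₂ b
      exact ⟨rfl, rfl, rfl⟩
  | iteTrue hb _ ih =>
    cases h₂ with
    | iteTrue _ a => obtain ⟨rfl, rfl, rfl⟩ := ih a; exact ⟨rfl, rfl, rfl⟩
    | iteFalse hb' _ => exact absurd hb hb'
  | iteFalse hb _ ih =>
    cases h₂ with
    | iteTrue hb' _ => exact absurd hb' hb
    | iteFalse _ a => obtain ⟨rfl, rfl, rfl⟩ := ih a; exact ⟨rfl, rfl, rfl⟩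
  | whileDone hb =>
    cases h₂ with
    | whileDone _ => exact ⟨rfl, rfl, rfl⟩
    | whileStep hb' _ _ => exact absurd hb' hb
  | whileStep hb _ _ ih₁ ih₂ =>
    cases h₂ with
    | whileDone hb' => exact absurd hb hb'
    | whileStep _ a b =>
      obtain ⟨rfl, rfl, rfl⟩ := ih₁ a
      obtain ⟨rfl, rfl, rfl⟩ := ih₂ b
      exact ⟨rfl, rfl, rfl⟩

/-- Every real symmetric matrix has a sorted eigendecomposition. -/
theorem exists_isEigendecomp {n : ℕ} (S : Matrix (Fin n) (Fin n) ℝ) (hS : S.IsSymm) :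
    ∃ Q t, IsEigendecomp S Q t := by
  have hS' : S.IsHermitian := by
    rw [Matrix.IsHermitian, Matrix.conjTranspose_eq_transpose_of_trivial]; exact hS
  let U : Matrix (Fin n) (Fin n) ℝ := hS'.eigenvectorUnitary.1
  have h1 : U.transpose * U = 1 := by
    have := Unitary.coe_star_mul_self hS'.eigenvectorUnitary
    rwa [Matrix.star_eq_conjTranspose, Matrix.conjTranspose_eq_transpose_of_trivial] at this
  have h2 : S = U * Matrix.diagonal hS'.eigenvalues * U.transpose := by
    have := hS'.spectral_theorem
    rw [Unitary.conjStarAlgAut_apply, Matrix.star_eq_conjTranspose,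
      Matrix.conjTranspose_eq_transpose_of_trivial] at this
    exact this
  let σ : Equiv.Perm (Fin n) := Tuple.sort hS'.eigenvalues
  refine ⟨U.submatrix id σ, hS'.eigenvalues ∘ σ, ?_, Tuple.monotone_sort _, ?_⟩
  · rw [Matrix.transpose_submatrix, ← Matrix.submatrix_mul _ _ _ _ _ Function.bijective_id, h1,
      Matrix.submatrix_one_equiv]
  · rw [← Matrix.submatrix_diagonal_equiv _ σ, Matrix.transpose_submatrix,
      Matrix.submatrix_mul_equiv, Matrix.submatrix_mul_equiv, Matrix.submatrix_id_id]
    exact h2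

/-- Exact eigensolvers exist. -/
theorem nonempty_eigensolver : Nonempty Eigensolver := by
  classical
  choose Q t h using fun (n : ℕ) (S : Matrix (Fin n) (Fin n) ℝ) => exists_isEigendecomp S
  refine ⟨⟨fun n S => if hS : S.IsSymm then Q n S hS else 0,
    fun n S => if hS : S.IsSymm then t n S hS else 0, fun n S hS => ?_⟩⟩
  simpa [hS] using h n S hS

end SpectralDesign

/-! The objective is minimized along a one-parameter path. Let `t` be the eigenvalues of `A`. By
Weyl's inequality and interlacing (`le_eigenvalue_add`, `eigenvalue_add_le`), the eigenvalues `l` of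
`A + X Xᵀ` satisfy `t_j ≤ l_j ≤ t_{j + min {d, k}}`, and their sum exceeds that of `t` by
`s = Tr (X Xᵀ) ∈ [0, k]`. Among all monotone vectors with these properties the water-filling vector
`t + β(s)` is majorized by every other one, since each of its entries lies between the entry of the
other vector and the water level (`mem_convexHull_perm`). So a symmetric convex `f` is minimal at
`t + β(s)` for some `s` (`exists_budget_le`).

Conversely, `t + β(s)` is a permutation of `t + β'(s)` by a telescoping sum (`sum_comp_add_fill`),
and so it consists of the eigenvalues of `A + X Xᵀ` whenever `X Xᵀ = Q diag(β'(s)) Qᵀ`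
(`infoEigs_eq_add_beta`). Such an `X` with equally long columns is obtained from the orthogonal
vectors `√β'_i Q e_i` by `k - 1` plane rotations, each of which makes one more column as long as the
average. To find the partner of the active column in constant time, the unused vectors are kept in
the order of their lengths: an active column that is too long is rotated with the shortest unused
vector, and one that is too short with the longest (`IsPartialBalancing.rotate`).

If `f` is non-increasing, then `s = k` is optimal because `β` is monotone in `s`. Otherwise,
`s ↦ f (t + β(s))` is convex (`IsSymmConvex.beta_convex`) and Lipschitz (`norm_beta_sub_le`), and
ternary search finds an `ε`-optimal `s`; it makes no oracle call if `k L / ε < 2`, as required by a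
bound that is linear in `log⁺ (k L / ε)` without an additive constant. The level `c(s)` is the least
of the averages `(s + t₁ + ⋯ + t_i) / i` with `i ≤ min {d, k}` (`IsLeastAverage.isLeast_level`), so
that each evaluation takes time `O(d)`.

The program is verified by a calculus of total correctness with running times (`Total`). Its rules
for instructions and sequences are equivalences, by which straight-line code is evaluated
symbolically; loops are treated by invariants (`Total.while_of`), which only mention what the loop
modifies, because `Exec.frame` takes care of everything else. -/

open Matrix

namespace SpectralDesign

/-! ### Water filling -/

/-- The amount by which the water level `c` exceeds the ground level `t j`, for the first
`min {d, k}` indices `j` only; `beta'` is this vector at the level `level t k s`. -/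
noncomputable def topFill {d : ℕ} (t : Fin d → ℝ) (k : ℕ) (c : ℝ) (j : Fin d) : ℝ :=
  if (j : ℕ) < min d k then max (c - t j) 0 else 0

theorem beta'_eq_topFill {d : ℕ} [NeZero d] (t : Fin d → ℝ) (k : ℕ) (s : ℝ) :
    beta' t k s = topFill t k (level t k s) := rfl

theorem add_fill {d : ℕ} (t : Fin d → ℝ) (k : ℕ) (c : ℝ) (j : Fin d) :
    t j + fill t k c j =
      if h : (j : ℕ) + min d k < d then min (max c (t j)) (t ⟨(j : ℕ) + min d k, h⟩)
      else max c (t j) := by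
  have h1 : t j + max (c - t j) 0 = max c (t j) := by rw [← max_add_add_left]; simp
  unfold fill
  split
  · rw [← min_add_add_left, h1]; simp
  · exact h1

theorem monotone_add_fill {d : ℕ} {t : Fin d → ℝ} (ht : Monotone t) (k : ℕ) (c : ℝ) :
    Monotone (t + fill t k c) := by
  intro i j hij
  have hij' : (i : ℕ) ≤ j := hij
  simp only [Pi.add_apply, add_fill]
  split_ifs with h1 h2 h2
  · exact min_le_min (max_le_max le_rfl (ht hij)) (ht (Fin.mk_le_mk.2 (by omega)))
  · exact (min_le_left _ _).trans (max_le_max le_rfl (ht hij))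
  · omega
  · exact max_le_max le_rfl (ht hij)

theorem fill_mono {d : ℕ} (t : Fin d → ℝ) (k : ℕ) (j : Fin d) :
    Monotone (fun c => fill t k c j) := by
  intro c c' h
  have h1 : max (c - t j) 0 ≤ max (c' - t j) 0 := max_le_max (by linarith) le_rfl
  simp only [fill]
  split
  · exact min_le_min h1 le_rfl
  · exact h1

theorem fill_nonneg {d : ℕ} {t : Fin d → ℝ} (ht : Monotone t) (k : ℕ) (c : ℝ) (j : Fin d) :
    0 ≤ fill t k c j := by
  unfold fill
  split
  · exact le_min (le_max_right _ _) (sub_nonneg.2 (ht (by simp [Fin.le_def])))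
  · exact le_max_right _ _

theorem sum_ite_add_lt {d m : ℕ} (hm : m ≤ d) (F : ℕ → ℝ) :
    ∑ j : Fin d, (if (j : ℕ) + m < d then F (j + m) else 0) =
      ∑ j : Fin d, (if (j : ℕ) < m then 0 else F j) := by
  obtain ⟨e, rfl⟩ := Nat.exists_eq_add_of_le hm
  have h1 : ∑ j ∈ Finset.range (m + e), (if j + m < m + e then F (j + m) else 0) =
      ∑ j ∈ Finset.range e, F (m + j) := by
    rw [add_comm m e, Finset.sum_range_add, Finset.sum_eq_zero (s := Finset.range m), add_zero]
    · refine Finset.sum_congr rfl fun j hj => ?_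
      rw [Finset.mem_range] at hj
      rw [if_pos (by omega), add_comm]
    · intro j _
      exact if_neg (by omega)
  have h2 : ∑ j ∈ Finset.range (m + e), (if j < m then 0 else F j) =
      ∑ j ∈ Finset.range e, F (m + j) := by
    rw [Finset.sum_range_add, Finset.sum_eq_zero (s := Finset.range m), zero_add]
    · exact Finset.sum_congr rfl fun j _ => if_neg (by omega)
    · exact fun j hj => if_pos (Finset.mem_range.1 hj)
  rw [Fin.sum_univ_eq_sum_range (fun j => if j + m < m + e then F (j + m) else 0),
    Fin.sum_univ_eq_sum_range (fun j => if j < m then 0 else F j), h1, h2]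

/-- The vectors `t + fill` and `t + topFill` agree up to a permutation, in the form that every
function has the same sum over their entries. A full bucket `j` contributes `g u_j`, and
`g (min (max c t_j) u_j) = g (max c t_j) - g (max c u_j) + g u_j`; as `u_j = t_{j + min {d, k}}`,
the sum over `j` telescopes. -/
theorem sum_comp_add_fill {d : ℕ} {t : Fin d → ℝ} (ht : Monotone t) (k : ℕ) (c : ℝ) (g : ℝ → ℝ) :
    ∑ j, g (t j + fill t k c j) = ∑ j, g (t j + topFill t k c j) := by
  let F : ℕ → ℝ := fun j => if h : j < d then g (max c (t ⟨j, h⟩)) - g (t ⟨j, h⟩) else 0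
  have h1 : ∀ j : Fin d, g (t j + fill t k c j) =
      g (max c (t j)) - if (j : ℕ) + min d k < d then F (j + min d k) else 0 := by
    intro j
    rw [add_fill]
    split
    · rename_i h
      have hle : t j ≤ t ⟨j + min d k, h⟩ := ht (by simp [Fin.le_def])
      simp only [F, dif_pos h]
      rcases le_total c (t ⟨j + min d k, h⟩) with hc | hc
      · rw [max_eq_right hc, min_eq_left (max_le hc hle)]; ring
      · rw [max_eq_left hc, max_eq_left (hle.trans hc), min_eq_right hc]; ring
    · simp
  have h2 : ∀ j : Fin d, g (t j + topFill t k c j) =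
      g (max c (t j)) - if (j : ℕ) < min d k then 0 else F j := by
    intro j
    unfold topFill
    split
    · rw [← max_add_add_left]; simp
    · simp [F]
  simp only [h1, h2, Finset.sum_sub_distrib]
  rw [sum_ite_add_lt (min_le_left d k)]

theorem map_add_fill {d : ℕ} {t : Fin d → ℝ} (ht : Monotone t) (k : ℕ) (c : ℝ) :
    (Finset.univ : Finset (Fin d)).val.map (t + fill t k c) =
      (Finset.univ : Finset (Fin d)).val.map (t + topFill t k c) := by
  classical
  ext a
  have := sum_comp_add_fill ht k c (fun x => if a = x then 1 else 0)
  rw [← Nat.cast_inj (R := ℝ), Multiset.count_map, Multiset.count_map]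
  simpa [← Finset.filter_val, Finset.sum_boole] using this

theorem sum_fill {d : ℕ} {t : Fin d → ℝ} (ht : Monotone t) (k : ℕ) (c : ℝ) :
    ∑ j, fill t k c j = ∑ j, topFill t k c j := by
  have := sum_comp_add_fill ht k c id
  simpa [Finset.sum_add_distrib] using this

theorem sum_topFill {d : ℕ} (t : Fin d → ℝ) (k : ℕ) (c : ℝ) (τ : ℕ → ℝ)
    (hτ : ∀ j : Fin d, t j = τ j) :
    ∑ j, topFill t k c j = ∑ j ∈ Finset.range (min d k), max (c - τ j) 0 := by
  have : ∀ j : Fin d, topFill t k c j = if (j : ℕ) < min d k then max (c - τ j) 0 else 0 := by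
    intro j; simp [topFill, hτ]
  simp only [this]
  rw [Fin.sum_univ_eq_sum_range (fun j => if j < min d k then max (c - τ j) 0 else 0)]
  rw [← Finset.sum_filter]
  congr 1
  ext j
  simp only [Finset.mem_filter, Finset.mem_range]
  omega

theorem mul_sub_sum_le_sum_max (τ : ℕ → ℝ) (c : ℝ) {i n : ℕ} (hi : i ≤ n) :
    i * c - ∑ j ∈ Finset.range i, τ j ≤ ∑ j ∈ Finset.range n, max (c - τ j) 0 := by
  calc i * c - ∑ j ∈ Finset.range i, τ j = ∑ j ∈ Finset.range i, (c - τ j) := by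
        simp [Finset.sum_sub_distrib]
    _ ≤ ∑ j ∈ Finset.range i, max (c - τ j) 0 := Finset.sum_le_sum fun _ _ => le_max_left _ _
    _ ≤ _ := Finset.sum_le_sum_of_subset_of_nonneg (Finset.range_mono hi)
        fun _ _ _ => le_max_right _ _

theorem exists_sum_max_eq (τ : ℕ → ℝ) (c : ℝ) (n : ℕ)
    (hτ : ∀ i j, i ≤ j → j < n → τ i ≤ τ j) :
    ∃ i ≤ n, ∑ j ∈ Finset.range n, max (c - τ j) 0 = i * c - ∑ j ∈ Finset.range i, τ j := by
  induction n with
  | zero => exact ⟨0, le_rfl, by simp⟩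
  | succ n ih =>
    rcases le_total c (τ n) with h | h
    · obtain ⟨i, hi, he⟩ := ih fun i j hij hj => hτ i j hij (by omega)
      exact ⟨i, by omega, by rw [Finset.sum_range_succ, he, max_eq_right (by linarith), add_zero]⟩
    · refine ⟨n + 1, le_rfl, ?_⟩
      rw [Finset.sum_congr rfl fun j hj => max_eq_left (b := 0) (sub_nonneg.2
        ((hτ j n (by have := Finset.mem_range.1 hj; omega) (by omega)).trans h))]
      simp [Finset.sum_sub_distrib]

/-- `c` is the least of the levels `(s + τ₀ + ⋯ + τ_{i-1}) / i` for `1 ≤ i ≤ n`, at which `s` units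
of water fill the first `i` of the buckets with ground levels `τ`. -/
def IsLeastAverage (τ : ℕ → ℝ) (n : ℕ) (s c : ℝ) : Prop :=
  IsLeast ((fun i : ℕ => (s + ∑ j ∈ Finset.range i, τ j) / i) '' Set.Icc 1 n) c

theorem exists_isLeastAverage (τ : ℕ → ℝ) {n : ℕ} (hn : 1 ≤ n) (s : ℝ) :
    ∃ c, IsLeastAverage τ n s c := by
  obtain ⟨i, hi, h⟩ := (Set.finite_Icc 1 n).exists_minimalFor
    (fun i : ℕ => (s + ∑ j ∈ Finset.range i, τ j) / i) _ ⟨1, by simp [hn]⟩ |>.imp fun i hi =>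
      (⟨hi.1, fun j hj => (le_total _ _).elim id fun h => hi.2 hj h⟩ :
        i ∈ Set.Icc 1 n ∧ ∀ j ∈ Set.Icc 1 n, (s + ∑ j ∈ Finset.range i, τ j) / i ≤
          (s + ∑ l ∈ Finset.range j, τ l) / j)
  exact ⟨_, ⟨i, hi, rfl⟩, by rintro _ ⟨j, hj, rfl⟩; exact h j hj⟩

section
variable {d : ℕ} [NeZero d] {k : ℕ} {t : Fin d → ℝ}

theorem one_le_min_neZero (d k : ℕ) [NeZero d] [NeZero k] : 1 ≤ min d k :=
  le_min (Nat.one_le_iff_ne_zero.2 (NeZero.ne d)) (Nat.one_le_iff_ne_zero.2 (NeZero.ne k))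

/-- The total amount of water is the maximum of the functions `c ↦ i c - (τ₀ + ⋯ + τ_{i-1})`,
so that it reaches `s` exactly at the least of the levels at which one of them reaches `s`. -/
theorem IsLeastAverage.isLeast_level (ht : Monotone t) {τ : ℕ → ℝ} (hτ : ∀ j : Fin d, t j = τ j)
    {s c : ℝ} (hs : 0 ≤ s) (hc : IsLeastAverage τ (min d k) s c) :
    IsLeast {c | t 0 ≤ c ∧ s ≤ ∑ j, fill t k c j} c ∧ ∑ j, fill t k c j = s := by
  have hmono : ∀ i j, i ≤ j → j < min d k → τ i ≤ τ j := by
    intro i j hij hj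
    have hj' : j < d := hj.trans_le (min_le_left _ _)
    have := ht (a := ⟨i, by omega⟩) (b := ⟨j, hj'⟩) hij
    simpa [hτ] using this
  obtain ⟨⟨i, hi, rfl⟩, hle⟩ := hc
  set c := (s + ∑ j ∈ Finset.range i, τ j) / i with hcdef
  have hi0 : (0 : ℝ) < i := by exact_mod_cast hi.1
  have hci : i * c - ∑ j ∈ Finset.range i, τ j = s := by
    rw [hcdef]; field_simp; ring
  have hsum : ∑ j, fill t k c j = s := by
    rw [sum_fill ht, sum_topFill t k c τ hτ]
    refine le_antisymm ?_ (hci.symm.le.trans (mul_sub_sum_le_sum_max τ c hi.2))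
    obtain ⟨l, hl, he⟩ := exists_sum_max_eq τ c _ hmono
    rw [he]
    rcases Nat.eq_zero_or_pos l with rfl | hl0
    · simpa using hs
    · have h := hle ⟨l, ⟨hl0, hl⟩, rfl⟩
      rw [le_div_iff₀ (by exact_mod_cast hl0)] at h
      linarith
  have h0 : t 0 ≤ c := by
    rw [hcdef, le_div_iff₀ hi0]
    have : ∑ j ∈ Finset.range i, τ 0 ≤ ∑ j ∈ Finset.range i, τ j :=
      Finset.sum_le_sum fun j hj => hmono 0 j (Nat.zero_le _)
        ((Finset.mem_range.1 hj).trans_le hi.2)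
    have h00 : t 0 = τ 0 := by simpa using hτ 0
    rw [h00]
    simp at this
    linarith
  refine ⟨⟨⟨h0, hsum.ge⟩, ?_⟩, hsum⟩
  rintro c' ⟨h0', hs'⟩
  rw [sum_fill ht, sum_topFill t k c' τ hτ] at hs'
  obtain ⟨l, hl, he⟩ := exists_sum_max_eq τ c' _ hmono
  rw [he] at hs'
  rcases Nat.eq_zero_or_pos l with rfl | hl0
  · -- only possible for `s = 0`, where the least level is `t₁`
    have hs0 : s = 0 := by simp at hs'; linarith
    have h := hle ⟨1, ⟨le_rfl, hi.1.trans hi.2⟩, rfl⟩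
    have h00 : t 0 = τ 0 := by simpa using hτ 0
    simp only [hs0, Finset.range_one, Finset.sum_singleton, Nat.cast_one, div_one, zero_add] at h ⊢
    linarith
  · have h := hle ⟨l, ⟨hl0, hl⟩, rfl⟩
    have hl0' : (0 : ℝ) < l := by exact_mod_cast hl0
    refine h.trans ?_
    simp only
    rw [div_le_iff₀ hl0']
    linarith

theorem IsLeastAverage.level_eq (ht : Monotone t) {τ : ℕ → ℝ} (hτ : ∀ j : Fin d, t j = τ j)
    {s c : ℝ} (hs : 0 ≤ s) (hc : IsLeastAverage τ (min d k) s c) : level t k s = c :=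
  (hc.isLeast_level ht hτ hs).1.csInf_eq

variable [NeZero k]

theorem level_spec (ht : Monotone t) {s : ℝ} (hs : 0 ≤ s) :
    IsLeast {c | t 0 ≤ c ∧ s ≤ ∑ j, fill t k c j} (level t k s) ∧ ∑ j, beta t k s j = s := by
  let τ : ℕ → ℝ := fun j => if h : j < d then t ⟨j, h⟩ else 0
  have hτ : ∀ j : Fin d, t j = τ j := fun j => by simp [τ]
  obtain ⟨c, hc⟩ := exists_isLeastAverage τ (one_le_min_neZero d k) s
  have h := hc.isLeast_level (k := k) ht hτ hs
  rw [beta, hc.level_eq ht hτ hs]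
  exact h

theorem sum_beta (ht : Monotone t) {s : ℝ} (hs : 0 ≤ s) : ∑ j, beta t k s j = s :=
  (level_spec ht hs).2

theorem sum_beta' (ht : Monotone t) {s : ℝ} (hs : 0 ≤ s) : ∑ j, beta' t k s j = s := by
  rw [beta'_eq_topFill, ← sum_fill ht]
  exact sum_beta ht hs

theorem beta_mono (ht : Monotone t) {s s' : ℝ} (hs : 0 ≤ s) (h : s ≤ s') :
    beta t k s ≤ beta t k s' := by
  intro j
  have h' := (level_spec (k := k) ht (hs.trans h)).1.1
  exact fill_mono t k j ((level_spec ht hs).1.2 ⟨h'.1, h.trans h'.2⟩)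

/-- All coordinates of `β` are non-decreasing in `s` and their sum is `s`, so that the `ℓ¹`-distance
of `β(s)` and `β(s')` is `|s - s'|`, which bounds the Euclidean distance. -/
theorem norm_beta_sub_le (ht : Monotone t) {s s' : ℝ} (hs : 0 ≤ s) (hs' : 0 ≤ s') :
    ‖WithLp.toLp 2 (beta t k s - beta t k s')‖ ≤ |s - s'| := by
  wlog h : s' ≤ s generalizing s s'
  · rw [abs_sub_comm, ← neg_sub, WithLp.toLp_neg, norm_neg]
    exact this hs' hs (le_of_not_ge h)
  have hnn : ∀ j, 0 ≤ beta t k s j - beta t k s' j := fun j => sub_nonneg.2 (beta_mono ht hs' h j)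
  have hsum : ∑ j, (beta t k s j - beta t k s' j) = s - s' := by
    rw [Finset.sum_sub_distrib, sum_beta ht hs, sum_beta ht hs']
  rw [abs_of_nonneg (sub_nonneg.2 h), EuclideanSpace.norm_eq]
  refine Real.sqrt_le_iff.2 ⟨sub_nonneg.2 h, ?_⟩
  rw [← hsum]
  simp only [Real.norm_eq_abs, sq_abs, Pi.sub_apply]
  exact Finset.sum_sq_le_sq_sum_of_nonneg fun j _ => hnn j
end

/-! ### Sorted eigenvalues and interlacing -/

theorem eq_of_monotone_of_map_eq {d : ℕ} {v w : Fin d → ℝ} (hv : Monotone v) (hw : Monotone w)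
    (h : (Finset.univ : Finset (Fin d)).val.map v = (Finset.univ : Finset (Fin d)).val.map w) :
    v = w := by
  rw [Fin.univ_val_map, Fin.univ_val_map, Multiset.coe_eq_coe] at h
  exact List.ofFn_injective (h.eq_of_sortedLE hv.sortedLE_ofFn hw.sortedLE_ofFn)

theorem sortedEigs_eq {d : ℕ} {M Q : Matrix (Fin d) (Fin d) ℝ} {v w : Fin d → ℝ}
    (hQ : Qᵀ * Q = 1) (hM : M = Q * diagonal v * Qᵀ) (hw : Monotone w)
    (h : (Finset.univ : Finset (Fin d)).val.map w = (Finset.univ : Finset (Fin d)).val.map v) :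
    sortedEigs M = w := by
  have hH : M.IsHermitian := by
    rw [Matrix.IsHermitian, conjTranspose_eq_transpose_of_trivial, hM]
    simp [transpose_mul, Matrix.mul_assoc]
  rw [sortedEigs, dif_pos hH]
  refine eq_of_monotone_of_map_eq ?_ hw ?_
  · intro i j hij
    exact hH.eigenvalues₀_antitone (Fin.rev_le_rev.2 hij : j.rev ≤ i.rev)
  · have h1 : M.charpoly.roots = (Finset.univ : Finset (Fin d)).val.map v := by
      rw [hM, charpoly_mul_comm, ← Matrix.mul_assoc, hQ, Matrix.one_mul, charpoly_diagonal,
        Polynomial.roots_prod]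
      · simp
      · simp [Finset.prod_ne_zero_iff, Polynomial.X_sub_C_ne_zero]
    rw [h, ← h1, hH.roots_charpoly_eq_eigenvalues₀]
    let e : Fin d ≃ Fin (Fintype.card (Fin d)) :=
      Fin.revPerm.trans (finCongr (Fintype.card_fin d).symm)
    have he : (fun i : Fin d => hH.eigenvalues₀ (Fin.cast (Fintype.card_fin d).symm i.rev)) =
      hH.eigenvalues₀ ∘ e := rfl
    rw [he, ← Multiset.map_map, Multiset.map_univ_val_equiv e]
    rfl

namespace IsEigendecomp

variable {d : ℕ} {S Q : Matrix (Fin d) (Fin d) ℝ} {t : Fin d → ℝ}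

theorem mul_transpose (h : IsEigendecomp S Q t) : Q * Qᵀ = 1 :=
  mul_eq_one_comm.1 h.orthogonal

theorem sortedEigs_eq (h : IsEigendecomp S Q t) : sortedEigs S = t :=
  SpectralDesign.sortedEigs_eq h.orthogonal h.eq h.sorted rfl

theorem sum_eq_trace (h : IsEigendecomp S Q t) : ∑ i, t i = S.trace := by
  rw [h.eq, trace_mul_comm, ← Matrix.mul_assoc, h.orthogonal, Matrix.one_mul, trace_diagonal]

theorem dotProduct_mulVec (h : IsEigendecomp S Q t) (v : Fin d → ℝ) :
    v ⬝ᵥ S *ᵥ v = ∑ i, t i * (Qᵀ *ᵥ v) i ^ 2 := by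
  conv_lhs => rw [h.eq, ← mulVec_mulVec, ← mulVec_mulVec, Matrix.dotProduct_mulVec,
    ← mulVec_transpose]
  simp only [dotProduct, mulVec_diagonal]
  exact Finset.sum_congr rfl fun i _ => by ring

theorem dotProduct_self (h : IsEigendecomp S Q t) (v : Fin d → ℝ) :
    v ⬝ᵥ v = ∑ i, (Qᵀ *ᵥ v) i ^ 2 := by
  conv_lhs => rw [← one_mulVec v, ← h.mul_transpose, ← mulVec_mulVec]
  rw [mulVec_mulVec, h.mul_transpose, one_mulVec]
  conv_lhs => enter [2]; rw [← one_mulVec v, ← h.mul_transpose, ← mulVec_mulVec]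
  rw [Matrix.dotProduct_mulVec, ← mulVec_transpose]
  simp only [dotProduct, sq]

theorem le_dotProduct (h : IsEigendecomp S Q t) {v : Fin d → ℝ} {j : Fin d}
    (hv : ∀ i < j, (Qᵀ *ᵥ v) i = 0) : t j * (v ⬝ᵥ v) ≤ v ⬝ᵥ S *ᵥ v := by
  rw [h.dotProduct_mulVec, h.dotProduct_self, Finset.mul_sum]
  refine Finset.sum_le_sum fun i _ => ?_
  rcases lt_or_ge i j with hi | hi
  · simp [hv i hi]
  · exact mul_le_mul_of_nonneg_right (h.sorted hi) (sq_nonneg _)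

theorem dotProduct_le (h : IsEigendecomp S Q t) {v : Fin d → ℝ} {j : Fin d}
    (hv : ∀ i, j < i → (Qᵀ *ᵥ v) i = 0) : v ⬝ᵥ S *ᵥ v ≤ t j * (v ⬝ᵥ v) := by
  rw [h.dotProduct_mulVec, h.dotProduct_self, Finset.mul_sum]
  refine Finset.sum_le_sum fun i _ => ?_
  rcases lt_or_ge j i with hi | hi
  · simp [hv i hi]
  · exact mul_le_mul_of_nonneg_right (h.sorted hi) (sq_nonneg _)

end IsEigendecomp

theorem exists_dotProduct_eq_zero {d : ℕ} {κ : Type*} [Fintype κ] (h : Fintype.card κ < d)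
    (W : κ → Fin d → ℝ) : ∃ v : Fin d → ℝ, 0 < v ⬝ᵥ v ∧ ∀ i, W i ⬝ᵥ v = 0 := by
  have hk : LinearMap.ker (Matrix.of W).mulVecLin ≠ ⊥ :=
    LinearMap.ker_ne_bot_of_finrank_lt (by simpa using h)
  obtain ⟨v, hv, hv0⟩ := Submodule.exists_mem_ne_zero_of_ne_bot hk
  refine ⟨v, ?_, fun i => congrFun (LinearMap.mem_ker.1 hv) i⟩
  have := dotProduct_star_self_pos_iff.2 hv0
  simpa using this

theorem add_mul_transpose_dotProduct {d k : ℕ} (A : Matrix (Fin d) (Fin d) ℝ)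
    (Y : Matrix (Fin d) (Fin k) ℝ) (v : Fin d → ℝ) :
    v ⬝ᵥ (A + Y * Yᵀ) *ᵥ v = v ⬝ᵥ A *ᵥ v + (Yᵀ *ᵥ v) ⬝ᵥ (Yᵀ *ᵥ v) := by
  rw [add_mulVec, dotProduct_add, ← mulVec_mulVec, Matrix.dotProduct_mulVec v Y,
    ← mulVec_transpose]

section Interlacing

variable {d k : ℕ} {A Q U : Matrix (Fin d) (Fin d) ℝ} {t l : Fin d → ℝ}
  {Y : Matrix (Fin d) (Fin k) ℝ}

/-- Weyl's monotonicity: adding `Y Yᵀ` does not decrease any eigenvalue. -/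
theorem le_eigenvalue_add (hA : IsEigendecomp A Q t) (hM : IsEigendecomp (A + Y * Yᵀ) U l) :
    t ≤ l := by
  intro j
  obtain ⟨v, hv, h⟩ := exists_dotProduct_eq_zero (d := d)
    (κ := {i : Fin d // i < j} ⊕ {i : Fin d // j < i})
    (by
      have := j.isLt
      simp only [Fintype.card_sum, Fintype.card_subtype, Finset.filter_gt_eq_Iio,
        Finset.filter_lt_eq_Ioi, Fin.card_Iio, Fin.card_Ioi]
      omega)
    (Sum.elim (fun i => Qᵀ i) (fun i => Uᵀ i))
  have h1 := hA.le_dotProduct (v := v) (j := j) fun i hi => h (Sum.inl ⟨i, hi⟩)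
  have h2 := hM.dotProduct_le (v := v) (j := j) fun i hi => h (Sum.inr ⟨i, hi⟩)
  rw [add_mul_transpose_dotProduct] at h2
  have h3 : 0 ≤ (Yᵀ *ᵥ v) ⬝ᵥ (Yᵀ *ᵥ v) :=
    Finset.sum_nonneg fun i _ => mul_self_nonneg _
  exact le_of_mul_le_mul_right (h1.trans (by linarith)) hv

/-- Interlacing: an update of rank at most `k` moves an eigenvalue by at most `k` positions. -/
theorem eigenvalue_add_le (hA : IsEigendecomp A Q t) (hM : IsEigendecomp (A + Y * Yᵀ) U l)
    (j : Fin d) (hj : (j : ℕ) + min d k < d) : l j ≤ t ⟨j + min d k, hj⟩ := by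
  have hk : min d k = k := by omega
  obtain ⟨v, hv, h⟩ := exists_dotProduct_eq_zero (d := d)
    (κ := {i : Fin d // i < j} ⊕ {i : Fin d // ⟨j + min d k, hj⟩ < i} ⊕ Fin k)
    (by
      simp only [Fintype.card_sum, Fintype.card_subtype, Finset.filter_gt_eq_Iio,
        Finset.filter_lt_eq_Ioi, Fin.card_Iio, Fin.card_Ioi,
        Fintype.card_fin]
      omega)
    (Sum.elim (fun i => Uᵀ i) (Sum.elim (fun i => Qᵀ i) (fun i => Yᵀ i)))
  have h1 := hM.le_dotProduct (v := v) (j := j) fun i hi => h (Sum.inl ⟨i, hi⟩)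
  have h2 := hA.dotProduct_le (v := v) (j := ⟨j + min d k, hj⟩)
    fun i hi => h (Sum.inr (Sum.inl ⟨i, hi⟩))
  have h3 : Yᵀ *ᵥ v = 0 := funext fun i => h (Sum.inr (Sum.inr i))
  rw [add_mul_transpose_dotProduct, h3, dotProduct_zero, add_zero] at h1
  exact le_of_mul_le_mul_right (h1.trans h2) hv

end Interlacing

/-! ### Schur convexity -/

section Schur

variable {d : ℕ} {f : (Fin d → ℝ) → EReal}

theorem IsSymmConvex.convex_sublevel (hf : IsSymmConvex f) (r : EReal) :
    Convex ℝ {x | f x ≤ r} := by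
  rw [convex_iff_forall_pos]
  intro x hx y hy a b ha hb hab
  have hx : f x ≤ r := hx
  have hy : f y ≤ r := hy
  refine (hf.convex x y a b ha hb hab).trans ?_
  induction r with
  | bot => exact absurd (le_bot_iff.1 hx) (hf.ne_bot x)
  | top => exact le_top
  | coe r =>
    calc (a : EReal) * f x + (b : EReal) * f y ≤ (a : EReal) * r + (b : EReal) * r :=
          add_le_add (mul_le_mul_of_nonneg_left hx (by exact_mod_cast ha.le))
            (mul_le_mul_of_nonneg_left hy (by exact_mod_cast hb.le))
      _ = ((a + b) * r : ℝ) := by rw [add_mul]; push_cast; rfl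
      _ ≤ r := by rw [hab, one_mul]

/-- If `x` and `l` are monotone vectors of equal sum and every `x j` lies between `l j` and `c`,
then `x` is majorized by `l`, so that `x` is in the convex hull of the permutations of `l`:
otherwise a linear functional `y` separates `x` from them, and for the non-decreasing
rearrangement of `y` the sum `∑ y j * (l j - x j)` is nonnegative because `l j - x j` changes
its sign only once, from negative to positive. -/
theorem mem_convexHull_perm {x l : Fin d → ℝ} (hx : Monotone x) (hl : Monotone l)
    (hsum : ∑ j, x j = ∑ j, l j) (c : ℝ) (h1 : ∀ j, l j < c → l j ≤ x j)
    (h2 : ∀ j, c ≤ l j → x j ≤ l j) :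
    x ∈ convexHull ℝ (Set.range fun σ : Equiv.Perm (Fin d) => l ∘ σ) := by
  by_contra hmem
  obtain ⟨φ, u, hu, hux⟩ := geometric_hahn_banach_closed_point (convex_convexHull ℝ _)
    ((Set.finite_range _).isClosed_convexHull ℝ) hmem
  let y : Fin d → ℝ := fun i => φ (Pi.single i 1)
  have hφ : ∀ z : Fin d → ℝ, φ z = ∑ i, z i * y i := by
    intro z
    conv_lhs => rw [pi_eq_sum_univ' z]
    simp [y]
  let σ := Tuple.sort y
  have hmono : Monotone (y ∘ σ) := Tuple.monotone_sort y
  have e1 : φ x ≤ ∑ i, x i * (y ∘ σ) i := by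
    have := (hx.monovary hmono).sum_mul_comp_perm_le_sum_mul (σ := σ⁻¹)
    rw [hφ]
    simpa using this
  have e2 : φ (l ∘ (σ⁻¹ : Equiv.Perm (Fin d))) = ∑ i, l i * (y ∘ σ) i := by
    rw [hφ, ← Equiv.sum_comp σ]
    simp
  have e3 : φ (l ∘ (σ⁻¹ : Equiv.Perm (Fin d))) < u := hu _ (subset_convexHull ℝ _ ⟨σ⁻¹, rfl⟩)
  obtain ⟨η, hη1, hη2⟩ : ∃ η, (∀ j, l j < c → (y ∘ σ) j ≤ η) ∧ ∀ j, c ≤ l j → η ≤ (y ∘ σ) j := by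
    by_cases hne : ∃ j, c ≤ l j
    · obtain ⟨p, hp, hmin⟩ := (Set.toFinite {j | c ≤ l j}).exists_minimal hne
      refine ⟨(y ∘ σ) p, fun j hj => hmono ?_, fun j hj => hmono ?_⟩
      · exact le_of_not_gt fun h => absurd (hp.trans (hl h.le)) (not_le.2 hj)
      · exact (le_total p j).elim id fun h => hmin hj h
    · obtain ⟨η, hη⟩ := (Set.finite_range (y ∘ σ)).bddAbove
      exact ⟨η, fun j _ => hη ⟨j, rfl⟩, fun j hj => absurd ⟨j, hj⟩ hne⟩
  have e4 : 0 ≤ ∑ i, (l i - x i) * ((y ∘ σ) i - η) := by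
    refine Finset.sum_nonneg fun i _ => ?_
    rcases lt_or_ge (l i) c with h | h
    · exact mul_nonneg_of_nonpos_of_nonpos (sub_nonpos.2 (h1 i h)) (sub_nonpos.2 (hη1 i h))
    · exact mul_nonneg (sub_nonneg.2 (h2 i h)) (sub_nonneg.2 (hη2 i h))
  have e5 : ∑ i, (l i - x i) * ((y ∘ σ) i - η) =
      ∑ i, l i * (y ∘ σ) i - ∑ i, x i * (y ∘ σ) i := by
    have : ∀ i, (l i - x i) * ((y ∘ σ) i - η) =
      l i * (y ∘ σ) i - x i * (y ∘ σ) i - η * (l i - x i) := fun i => by ring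
    simp only [this, Finset.sum_sub_distrib, ← Finset.mul_sum]
    rw [hsum]
    ring
  linarith

end Schur

section
variable {d : ℕ} [NeZero d] {k : ℕ} {t : Fin d → ℝ} {f : (Fin d → ℝ) → EReal}
  {A Q : Matrix (Fin d) (Fin d) ℝ}

theorem add_beta_le_upper {s : ℝ} (j : Fin d) (h : (j : ℕ) + min d k < d) :
    (t + beta t k s) j ≤ t ⟨j + min d k, h⟩ := by
  simp only [Pi.add_apply, beta, add_fill, dif_pos h]
  exact min_le_right _ _

theorem infoEigs_eq_add_beta (hA : IsEigendecomp A Q t) {s : ℝ} {X : Matrix (Fin d) (Fin k) ℝ}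
    (hX : X * Xᵀ = Q * diagonal (beta' t k s) * Qᵀ) : infoEigs A X = t + beta t k s := by
  refine sortedEigs_eq (v := t + beta' t k s) hA.orthogonal ?_ (monotone_add_fill hA.sorted k _)
    (map_add_fill hA.sorted k _)
  rw [hX]
  conv_lhs => enter [1]; rw [hA.eq]
  rw [← Matrix.add_mul, ← Matrix.mul_add, diagonal_add]
  rfl

/-- The result of the factorization step: `X Xᵀ = Q diag(β'(s)) Qᵀ`, with equally long columns. -/
structure IsBalancedDesign (Q : Matrix (Fin d) (Fin d) ℝ) (t : Fin d → ℝ) (s : ℝ)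
    (X : Matrix (Fin d) (Fin k) ℝ) : Prop where
  gram : X * Xᵀ = Q * diagonal (beta' t k s) * Qᵀ
  col : ∀ j, ∑ i, X i j ^ 2 = s / k

theorem IsBalancedDesign.feasible {s : ℝ} (hs : s ≤ k) {X : Matrix (Fin d) (Fin k) ℝ}
    (hX : IsBalancedDesign Q t s X) : Feasible X := by
  intro j
  rw [hX.col]
  exact div_le_one_of_le₀ hs (Nat.cast_nonneg _)

variable [NeZero k]

/-- Among all monotone vectors `l` with `t_j ≤ l_j ≤ t_{j + min {d, k}}` and a given sum, water
filling minimizes every symmetric convex function. -/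
theorem IsSymmConvex.add_beta_le (hf : IsSymmConvex f) (ht : Monotone t) {l : Fin d → ℝ}
    (hl : Monotone l) (h1 : t ≤ l)
    (h2 : ∀ (j : Fin d) (h : (j : ℕ) + min d k < d), l j ≤ t ⟨j + min d k, h⟩) {s : ℝ}
    (hs : ∑ j, l j - ∑ j, t j = s) : f (t + beta t k s) ≤ f l := by
  have hs0 : 0 ≤ s := hs ▸ sub_nonneg.2 (Finset.sum_le_sum fun j _ => h1 j)
  have hmem : t + beta t k s ∈ convexHull ℝ (Set.range fun σ : Equiv.Perm (Fin d) => l ∘ σ) := by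
    refine mem_convexHull_perm (monotone_add_fill ht k _) hl ?_ (level t k s) ?_ ?_
    · simp only [Pi.add_apply, Finset.sum_add_distrib, sum_beta ht hs0]
      linarith
    · intro j hj
      simp only [Pi.add_apply, beta, add_fill]
      split
      · exact le_min (le_max_of_le_left hj.le) (h2 j _)
      · exact le_max_of_le_left hj.le
    · intro j hj
      simp only [Pi.add_apply, beta, add_fill]
      split
      · exact (min_le_left _ _).trans (max_le hj (h1 j))
      · exact max_le hj (h1 j)
  refine convexHull_min ?_ (hf.convex_sublevel (f l)) hmem
  rintro _ ⟨σ, rfl⟩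
  exact (hf.symm σ l).le

/-- The objective is convex along the water-filling path, since a convex combination of two points
of the path satisfies the constraints under which water filling is optimal. -/
theorem IsSymmConvex.beta_convex (hf : IsSymmConvex f) (ht : Monotone t) {s s' a b : ℝ}
    (hs : 0 ≤ s) (hs' : 0 ≤ s') (ha : 0 < a) (hb : 0 < b) (hab : a + b = 1) :
    f (t + beta t k (a * s + b * s')) ≤
      (a : EReal) * f (t + beta t k s) + (b : EReal) * f (t + beta t k s') := by
  refine (hf.add_beta_le ht (l := a • (t + beta t k s) + b • (t + beta t k s')) ?_ ?_ ?_ ?_).trans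
    (hf.convex _ _ a b ha hb hab)
  · exact ((monotone_add_fill ht k _).const_smul ha.le).add
      ((monotone_add_fill ht k _).const_smul hb.le)
  · intro j
    have h1 := fill_nonneg ht k (level t k s) j
    have h2 := fill_nonneg ht k (level t k s') j
    simp only [Pi.add_apply, Pi.smul_apply, smul_eq_mul, beta]
    calc t j = a * t j + b * t j := by rw [← add_mul, hab, one_mul]
      _ ≤ _ := by gcongr <;> linarith
  · intro j h
    have h1 := add_beta_le_upper (t := t) (s := s) j h
    have h2 := add_beta_le_upper (t := t) (s := s') j h
    simp only [Pi.add_apply, Pi.smul_apply, smul_eq_mul] at h1 h2 ⊢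
    calc _ ≤ a * t ⟨j + min d k, h⟩ + b * t ⟨j + min d k, h⟩ := by gcongr
      _ = _ := by rw [← add_mul, hab, one_mul]
  · simp only [Pi.add_apply, Pi.smul_apply, smul_eq_mul, Finset.sum_add_distrib, ← Finset.mul_sum,
      sum_beta ht hs, sum_beta ht hs']
    linear_combination (∑ j, t j) * hab

/-! ### Optimality of the outputs of the algorithm -/

/-- Every feasible design is at least as costly as some point of the water-filling path. -/
theorem exists_budget_le (hf : IsSymmConvex f) (hA : IsEigendecomp A Q t)
    {Y : Matrix (Fin d) (Fin k) ℝ} (hY : Feasible Y) :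
    ∃ s ∈ Set.Icc (0 : ℝ) k, f (t + beta t k s) ≤ f (infoEigs A Y) := by
  have hsymm : (A + Y * Yᵀ).IsSymm := by
    rw [Matrix.IsSymm, hA.eq]
    simp [transpose_mul, Matrix.mul_assoc]
  obtain ⟨U, l, hM⟩ := exists_isEigendecomp _ hsymm
  rw [infoEigs, hM.sortedEigs_eq]
  have htr : ∑ j, l j - ∑ j, t j = ∑ j, ∑ i, Y i j ^ 2 := by
    rw [hA.sum_eq_trace, hM.sum_eq_trace, trace_add, add_sub_cancel_left, Finset.sum_comm]
    simp [trace, mul_apply, sq]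
  refine ⟨_, ⟨?_, ?_⟩, hf.add_beta_le hA.sorted hM.sorted (le_eigenvalue_add hA hM)
    (eigenvalue_add_le hA hM) htr⟩
  · positivity
  · calc ∑ j, ∑ i, Y i j ^ 2 ≤ ∑ j : Fin k, (1 : ℝ) := Finset.sum_le_sum fun j _ => hY j
      _ = k := by simp

theorem isAlgorithmOutput_iff {mono : Bool} {ε : ℝ} {X : Matrix (Fin d) (Fin k) ℝ} :
    IsAlgorithmOutput A mono f ε X ↔ ∃ Q t s, IsEigendecomp A Q t ∧ IsBudget t k mono f ε s ∧
      IsBalancedDesign Q t s X := by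
  have hs : ∀ {t : Fin d → ℝ} {s}, IsBudget t k mono f ε s → 0 ≤ s := by
    intro t s h
    unfold IsBudget at h
    split at h
    · rw [h]; positivity
    · exact h.1.1
  have hcol : ∀ (X : Matrix (Fin d) (Fin k) ℝ) j, (Xᵀ * X) j j = ∑ i, X i j ^ 2 := by
    intro X j
    simp [mul_apply, sq]
  constructor
  · rintro ⟨Q, t, s, Z, hA, hb, hZ, hcolZ, rfl⟩
    refine ⟨Q, t, s, hA, hb, ?_, fun j => ?_⟩
    · rw [transpose_mul, ← hZ]; simp only [Matrix.mul_assoc]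
    · rw [← sum_beta' (k := k) hA.sorted (hs hb), ← hcolZ j, ← hcol, transpose_mul,
        Matrix.mul_assoc, ← Matrix.mul_assoc Qᵀ, hA.orthogonal, Matrix.one_mul]
  · rintro ⟨Q, t, s, hA, hb, hg, hc⟩
    refine ⟨Q, t, s, Qᵀ * X, hA, hb, ?_, fun j => ?_, ?_⟩
    · rw [transpose_mul, transpose_transpose, ← Matrix.mul_assoc, Matrix.mul_assoc Qᵀ, hg,
        ← Matrix.mul_assoc, ← Matrix.mul_assoc, hA.orthogonal, Matrix.one_mul, Matrix.mul_assoc,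
        hA.orthogonal, Matrix.mul_one]
    · rw [sum_beta' hA.sorted (hs hb), ← hc j, ← hcol, transpose_mul, transpose_transpose,
        Matrix.mul_assoc, ← Matrix.mul_assoc Q, hA.mul_transpose, Matrix.one_mul]
    · rw [← Matrix.mul_assoc, hA.mul_transpose, Matrix.one_mul]

theorem isOptimal_of_isAlgorithmOutput (hf : IsSymmConvex f) (hanti : Antitone f) {ε : ℝ}
    {X : Matrix (Fin d) (Fin k) ℝ} (hX : IsAlgorithmOutput A true f ε X) : IsOptimal A f X := by
  obtain ⟨Q, t, s, hA, hb, hX⟩ := isAlgorithmOutput_iff.1 hX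
  have hs : s = k := hb
  refine ⟨hX.feasible hs.le, fun Y hY => ?_⟩
  obtain ⟨s', hs', hle⟩ := exists_budget_le hf hA hY
  rw [infoEigs_eq_add_beta hA hX.gram]
  exact (hanti (add_le_add le_rfl (beta_mono hA.sorted hs'.1 (hs'.2.trans hs.ge)))).trans hle

theorem isEpsOptimal_of_isAlgorithmOutput (hf : IsSymmConvex f) {ε : ℝ} (hε : 0 ≤ ε) {mono : Bool}
    (hmono : mono = true → Antitone f) {X : Matrix (Fin d) (Fin k) ℝ}
    (hX : IsAlgorithmOutput A mono f ε X) : IsEpsOptimal A f ε X := by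
  cases mono with
  | true =>
    obtain ⟨h1, h2⟩ := isOptimal_of_isAlgorithmOutput hf (hmono rfl) hX
    exact ⟨h1, fun Y hY => (h2 Y hY).trans (le_add_of_nonneg_right (by exact_mod_cast hε))⟩
  | false =>
    obtain ⟨Q, t, s, hA, hb, hX⟩ := isAlgorithmOutput_iff.1 hX
    obtain ⟨hs, hopt⟩ : s ∈ Set.Icc (0 : ℝ) k ∧ ∀ s' ∈ Set.Icc (0 : ℝ) k,
      f (t + beta t k s) ≤ f (t + beta t k s') + (ε : EReal) := by simpa [IsBudget] using hb
    refine ⟨hX.feasible hs.2, fun Y hY => ?_⟩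
    obtain ⟨s', hs', hle⟩ := exists_budget_le hf hA hY
    rw [infoEigs_eq_add_beta hA hX.gram]
    exact (hopt s' hs').trans (by gcongr)

end

/-! ### Equalizing the lengths of orthogonal vectors by plane rotations -/

/-- The state after `n` plane rotations of the orthogonal vectors `y 0, …, y (k - 1)` of squared
lengths `b`: the columns `0, …, n - 1` of `X` have the target squared length `m`, the column `n` has
the squared length `a`, and the vectors `y i` with `lo ≤ i < hi` have not been used yet. -/
structure IsPartialBalancing {d : ℕ} (y : Fin d → ℕ → ℝ) (b : ℕ → ℝ) (m : ℝ) (k n lo hi : ℕ)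
    (X : Fin d → ℕ → ℝ) (a : ℝ) : Prop where
  lo_le : lo ≤ hi
  hi_le : hi ≤ k
  count : lo + k = hi + n + 1
  gram : ∀ r r', ∑ c ∈ Finset.range (n + 1), X r c * X r' c +
    ∑ i ∈ Finset.Ico lo hi, y r i * y r' i = ∑ i ∈ Finset.range k, y r i * y r' i
  col : ∀ c < n, ∑ r, X r c ^ 2 = m
  active : ∑ r, X r n ^ 2 = a
  orth : ∀ i, lo ≤ i → i < hi → ∑ r, X r n * y r i = 0
  mean : a + ∑ i ∈ Finset.Ico lo hi, b i = m * (k - n)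

namespace IsPartialBalancing

variable {d : ℕ} {y : Fin d → ℕ → ℝ} {b : ℕ → ℝ} {m : ℝ} {k n lo hi : ℕ} {X : Fin d → ℕ → ℝ}
  {a : ℝ}

/-- The column `n` is rotated with an unused vector `y q`. -/
theorem rotate (h : IsPartialBalancing y b m k n lo hi X a)
    (hy : ∀ i < k, ∀ j < k, ∑ r, y r i * y r j = if i = j then b i else 0) (hlt : lo < hi)
    {q lo' hi' : ℕ} (hq : q = lo ∧ lo' = lo + 1 ∧ hi' = hi ∨ q = hi - 1 ∧ lo' = lo ∧ hi' = hi - 1)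
    {C S : ℝ} (hCS : C ^ 2 + S ^ 2 = 1) (hm : C ^ 2 * a + S ^ 2 * b q = m)
    {X' : Fin d → ℕ → ℝ} (h0 : ∀ r, ∀ c < n, X' r c = X r c)
    (h1 : ∀ r, X' r n = C * X r n + S * y r q)
    (h2 : ∀ r, X' r (n + 1) = C * y r q - S * X r n) :
    IsPartialBalancing y b m k (n + 1) lo' hi' X' (a + b q - m) := by
  have hsplit : ∀ F : ℕ → ℝ,
      ∑ i ∈ Finset.Ico lo hi, F i = F q + ∑ i ∈ Finset.Ico lo' hi', F i := by
    intro F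
    rcases hq with ⟨rfl, rfl, rfl⟩ | ⟨rfl, rfl, rfl⟩
    · exact Finset.sum_eq_sum_Ico_succ_bot hlt F
    · obtain ⟨e, rfl⟩ := Nat.exists_eq_add_of_lt hlt
      rw [show lo' + e + 1 = (lo' + e) + 1 from rfl, Finset.sum_Ico_succ_top (by omega), add_comm]
      rfl
  have hqk : q < k ∧ lo ≤ q ∧ q < hi ∧ lo ≤ lo' ∧ hi' ≤ hi ∧ (q < lo' ∨ hi' ≤ q) := by
    have := h.hi_le
    omega
  obtain ⟨hqk, hq1, hq2, hl, hh, hqn⟩ := hqk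
  have hqq : ∑ r, y r q ^ 2 = b q := by
    have := hy q hqk q hqk
    simpa [sq] using this
  have hXq := h.orth q hq1 hq2
  have hact := h.active
  have hn1 : ∑ r, X' r n ^ 2 = m := by
    have : ∀ r, X' r n ^ 2 = C ^ 2 * X r n ^ 2 + S ^ 2 * y r q ^ 2 +
        2 * C * S * (X r n * y r q) := fun r => by rw [h1]; ring
    simp only [this, Finset.sum_add_distrib, ← Finset.mul_sum, hXq, hqq, hact]
    linarith
  refine ⟨by have := h.lo_le; omega, hh.trans h.hi_le, by have := h.count; omega, fun r r' => ?_,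
    fun c hc => ?_, ?_, fun i hi1 hi2 => ?_, ?_⟩
  · rw [← h.gram r r', hsplit, Finset.sum_range_succ _ (n + 1), Finset.sum_range_succ,
      Finset.sum_range_succ, h1, h1, h2, h2, Finset.sum_congr rfl fun c hc => by
      rw [h0 r c (Finset.mem_range.1 hc), h0 r' c (Finset.mem_range.1 hc)]]
    linear_combination (X r n * X r' n + y r q * y r' q) * hCS
  · rcases Nat.lt_succ_iff_lt_or_eq.1 hc with hc | rfl
    · rw [← h.col c hc]
      exact Finset.sum_congr rfl fun r _ => by rw [h0 r c hc]
    · exact hn1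
  · have : ∀ r, X' r (n + 1) ^ 2 = C ^ 2 * y r q ^ 2 + S ^ 2 * X r n ^ 2 -
        2 * C * S * (X r n * y r q) := fun r => by rw [h2]; ring
    simp only [this, Finset.sum_add_distrib, Finset.sum_sub_distrib, ← Finset.mul_sum, hXq, hqq,
      hact]
    linear_combination -hm + (a + b q) * hCS
  · have : ∀ r, X' r (n + 1) * y r i = C * (y r q * y r i) - S * (X r n * y r i) :=
      fun r => by rw [h2]; ring
    have hiq : q ≠ i := by omega
    simp only [this, Finset.sum_sub_distrib, ← Finset.mul_sum,
      hy q hqk i (by have := h.hi_le; omega), h.orth i (by omega) (by omega), if_neg hiq]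
    ring
  · have := h.mean
    rw [hsplit] at this
    push_cast
    linarith

theorem le_of_le_active (h : IsPartialBalancing y b m k n lo hi X a) (hlt : lo < hi)
    (hb : ∀ i j, i ≤ j → j < k → b j ≤ b i) (ha : m ≤ a) : b (hi - 1) ≤ m := by
  have h1 : ∑ i ∈ Finset.Ico lo hi, b (hi - 1) ≤ ∑ i ∈ Finset.Ico lo hi, b i :=
    Finset.sum_le_sum fun i hi' => by
      rw [Finset.mem_Ico] at hi'
      exact hb _ _ (by omega) (by have := h.hi_le; omega)
  have h2 := h.mean
  have h3 : (k : ℝ) - n = hi - lo + 1 := by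
    have : (lo + k : ℝ) = hi + n + 1 := by exact_mod_cast h.count
    linarith
  have h4 : (lo : ℝ) < hi := by exact_mod_cast hlt
  rw [Finset.sum_const, Nat.card_Ico, nsmul_eq_mul, Nat.cast_sub hlt.le] at h1
  rw [h3] at h2
  by_contra hc
  nlinarith [mul_pos (sub_pos.2 h4) (sub_pos.2 (not_le.1 hc))]

theorem le_of_active_le (h : IsPartialBalancing y b m k n lo hi X a) (hlt : lo < hi)
    (hb : ∀ i j, i ≤ j → j < k → b j ≤ b i) (ha : a ≤ m) : m ≤ b lo := by
  have h1 : ∑ i ∈ Finset.Ico lo hi, b i ≤ ∑ i ∈ Finset.Ico lo hi, b lo :=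
    Finset.sum_le_sum fun i hi' => by
      rw [Finset.mem_Ico] at hi'
      exact hb _ _ (by omega) (by have := h.hi_le; omega)
  have h2 := h.mean
  have h3 : (k : ℝ) - n = hi - lo + 1 := by
    have : (lo + k : ℝ) = hi + n + 1 := by exact_mod_cast h.count
    linarith
  have h4 : (lo : ℝ) < hi := by exact_mod_cast hlt
  rw [Finset.sum_const, Nat.card_Ico, nsmul_eq_mul, Nat.cast_sub hlt.le] at h1
  rw [h3] at h2
  by_contra hc
  nlinarith [mul_pos (sub_pos.2 h4) (sub_pos.2 (not_le.1 hc))]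

theorem active_eq (h : IsPartialBalancing y b m k n lo hi X a) (hn : n + 1 = k) : a = m := by
  have h1 : lo = hi := by have := h.count; omega
  have h2 := h.mean
  rw [h1, Finset.Ico_self, Finset.sum_empty, ← hn] at h2
  push_cast at h2
  linarith

end IsPartialBalancing

/-- The squared cosine of the rotation of orthogonal vectors of squared lengths `a` and `b` after
which the first of them has squared length `m`. -/
noncomputable def rotationWeight (a b m : ℝ) : ℝ :=
  if a = b then 1 else (b - m) / (b - a)

theorem rotationWeight_spec {a b m : ℝ} (h : a ≤ m ∧ m ≤ b ∨ b ≤ m ∧ m ≤ a) :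
    0 ≤ rotationWeight a b m ∧ rotationWeight a b m ≤ 1 ∧
      rotationWeight a b m * a + (1 - rotationWeight a b m) * b = m := by
  unfold rotationWeight
  split_ifs with hab
  · refine ⟨zero_le_one, le_rfl, ?_⟩
    rcases h with h | h <;> linarith
  · have hne : b - a ≠ 0 := sub_ne_zero.2 (Ne.symm hab)
    refine ⟨?_, ?_, by field_simp; ring⟩
    · rcases h with h | h
      · exact div_nonneg (by linarith) (by linarith)
      · exact div_nonneg_of_nonpos (by linarith) (by linarith)
    · rcases h with h | h
      · exact div_le_one_of_le₀ (by linarith) (by linarith)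
      · exact div_le_one_of_ge (by linarith) (by linarith)

/-! ### Total correctness with running times -/

section
variable (E : Eigensolver) {d : ℕ} (f : (Fin d → ℝ) → EReal)

/-- Total correctness: `p` started in `M` halts, in a memory, after a time and after a number of
oracle calls that satisfy `Q`. -/
def Total (p : Program) (M : Memory) (Q : Memory → ℕ → ℕ → Prop) : Prop :=
  ∃ M' T N, Exec E f p M M' T N ∧ Q M' T N

end

namespace Total
variable {E : Eigensolver} {d : ℕ} {f : (Fin d → ℝ) → EReal} {p q : Program} {b : Test}
  {M : Memory} {Q Q' : Memory → ℕ → ℕ → Prop}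

theorem mono (h : Total E f p M Q) (hQ : ∀ M' T N, Q M' T N → Q' M' T N) : Total E f p M Q' := by
  obtain ⟨M', T, N, h1, h2⟩ := h
  exact ⟨M', T, N, h1, hQ _ _ _ h2⟩

theorem instr_iff {I : Instr} :
    Total E f (.instr I) M Q ↔ Q (I.effect E f M) (I.time d M) I.calls := by
  constructor
  · rintro ⟨M', T, N, h, hQ⟩
    cases h
    exact hQ
  · exact fun h => ⟨_, _, _, .instr I M, h⟩

theorem seq_iff : Total E f (.seq p q) M Q ↔
    Total E f p M fun M₁ T₁ N₁ => Total E f q M₁ fun M₂ T₂ N₂ => Q M₂ (T₁ + T₂) (N₁ + N₂) := by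
  constructor
  · rintro ⟨M', T, N, h, hQ⟩
    cases h with
    | seq h1 h2 => exact ⟨_, _, _, h1, _, _, _, h2, hQ⟩
  · rintro ⟨_, _, _, h1, _, _, _, h2, hQ⟩
    exact ⟨_, _, _, .seq h1 h2, hQ⟩

theorem ite_of (h1 : b.Holds M → Total E f p M fun M' T N => Q M' (T + 1) N)
    (h2 : ¬ b.Holds M → Total E f q M fun M' T N => Q M' (T + 1) N) :
    Total E f (.ite b p q) M Q := by
  by_cases hb : b.Holds M
  · obtain ⟨M', T, N, h, hQ⟩ := h1 hb
    exact ⟨_, _, _, .iteTrue hb h, hQ⟩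
  · obtain ⟨M', T, N, h, hQ⟩ := h2 hb
    exact ⟨_, _, _, .iteFalse hb h, hQ⟩

end Total

namespace Program

/-- Sequential composition of a list of programs, closed by an instruction that overwrites a
register which is used for nothing else. -/
def block (l : List Program) : Program :=
  l.foldr .seq (.instr (.setNat 30 0))

/-- The registers for natural numbers that a program may overwrite. -/
def natWrites : Program → List ℕ
  | .instr (.setNat i _) => [i]
  | .instr (.natOp _ i _ _) => [i]
  | .instr (.query _ _ g) => [g]
  | .instr _ => []
  | .seq p q => p.natWrites ++ q.natWrites
  | .ite _ p q => p.natWrites ++ q.natWrites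
  | .while _ p => p.natWrites

/-- The registers for reals that a program may overwrite. -/
def realWrites : Program → List ℕ
  | .instr (.ofNat i _) => [i]
  | .instr (.realOp _ i _ _) => [i]
  | .instr (.sqrt i _) => [i]
  | .instr (.load i _ _ _) => [i]
  | .instr (.query _ v _) => [v]
  | .instr _ => []
  | .seq p q => p.realWrites ++ q.realWrites
  | .ite _ p q => p.realWrites ++ q.realWrites
  | .while _ p => p.realWrites

/-- The arrays that a program may modify. -/
def arrWrites : Program → List ℕ
  | .instr (.store a _ _ _) => [a]
  | .instr (.eig _ _ q t) => [q, t]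
  | .instr _ => []
  | .seq p q => p.arrWrites ++ q.arrWrites
  | .ite _ p q => p.arrWrites ++ q.arrWrites
  | .while _ p => p.arrWrites

end Program

/-- `M` and `M'` agree outside the registers and arrays that `p` may overwrite. -/
structure Frame (p : Program) (M M' : Memory) : Prop where
  nat : ∀ i, i ∉ p.natWrites → M'.nat i = M.nat i
  real : ∀ i, i ∉ p.realWrites → M'.real i = M.real i
  arr : ∀ a, a ∉ p.arrWrites → M'.arr a = M.arr a

theorem Frame.refl (p : Program) (M : Memory) : Frame p M M :=
  ⟨fun _ _ => rfl, fun _ _ => rfl, fun _ _ => rfl⟩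

theorem Frame.trans {p : Program} {M M' M'' : Memory} (h : Frame p M M') (h' : Frame p M' M'') :
    Frame p M M'' :=
  ⟨fun i hi => (h'.nat i hi).trans (h.nat i hi), fun i hi => (h'.real i hi).trans (h.real i hi),
    fun i hi => (h'.arr i hi).trans (h.arr i hi)⟩

theorem Frame.weaken {p q : Program} {M M' : Memory} (h : Frame p M M')
    (h1 : p.natWrites ⊆ q.natWrites) (h2 : p.realWrites ⊆ q.realWrites)
    (h3 : p.arrWrites ⊆ q.arrWrites) : Frame q M M' :=
  ⟨fun i hi => h.nat i fun hp => hi (h1 hp), fun i hi => h.real i fun hp => hi (h2 hp),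
    fun i hi => h.arr i fun hp => hi (h3 hp)⟩

theorem Frame.instr {E : Eigensolver} {d : ℕ} {f : (Fin d → ℝ) → EReal} (I : Instr) (M : Memory) :
    Frame (.instr I) M (I.effect E f M) := by
  cases I <;> refine ⟨fun i hi => ?_, fun i hi => ?_, fun a ha => ?_⟩ <;>
    first
    | rfl
    | (simp only [Program.natWrites, Program.realWrites, List.mem_singleton] at hi
       simp only [Instr.effect]
       exact Function.update_of_ne hi _ _)
    | (simp only [Program.arrWrites, List.mem_cons, List.not_mem_nil, or_false, not_or] at ha
       funext r c
       simp [Instr.effect, Memory.setEntry, Memory.setBlock, ha])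

theorem Exec.frame {E : Eigensolver} {d : ℕ} {f : (Fin d → ℝ) → EReal} {p : Program}
    {M M' : Memory} {T N : ℕ} (h : Exec E f p M M' T N) : Frame p M M' := by
  induction h with
  | instr I M => exact .instr I M
  | seq _ _ ih1 ih2 =>
    exact (ih1.weaken (by simp [Program.natWrites]) (by simp [Program.realWrites])
      (by simp [Program.arrWrites])).trans (ih2.weaken (by simp [Program.natWrites])
      (by simp [Program.realWrites]) (by simp [Program.arrWrites]))
  | iteTrue _ _ ih =>
    exact ih.weaken (by simp [Program.natWrites]) (by simp [Program.realWrites])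
      (by simp [Program.arrWrites])
  | iteFalse _ _ ih =>
    exact ih.weaken (by simp [Program.natWrites]) (by simp [Program.realWrites])
      (by simp [Program.arrWrites])
  | whileDone _ => exact .refl _ _
  | whileStep _ _ _ ih1 ih2 =>
    exact Frame.trans (p := .while _ _) (ih1.weaken (List.Subset.refl _) (List.Subset.refl _)
      (List.Subset.refl _)) ih2

namespace Total
variable {E : Eigensolver} {d : ℕ} {f : (Fin d → ℝ) → EReal} {p q : Program} {b : Test}
  {M : Memory} {Q : Memory → ℕ → ℕ → Prop}

theorem frame (h : Total E f p M Q) : Total E f p M fun M' T N => Frame p M M' ∧ Q M' T N := by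
  obtain ⟨M', T, N, h1, h2⟩ := h
  exact ⟨M', T, N, h1, h1.frame, h2⟩

theorem block_nil_iff : Total E f (.block []) M Q ↔
    Q { M with nat := Function.update M.nat 30 0 } 1 0 :=
  instr_iff

theorem block_cons_iff {l : List Program} : Total E f (.block (p :: l)) M Q ↔
    Total E f p M fun M₁ T₁ N₁ =>
      Total E f (.block l) M₁ fun M₂ T₂ N₂ => Q M₂ (T₁ + T₂) (N₁ + N₂) :=
  seq_iff

/-- A loop whose `n`-th iteration leads from the invariant `I n` to `I (n + 1)`, and which performs
at most `K` iterations of time at most `B` with at most `c` oracle calls. -/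
theorem while_of (I : ℕ → Memory → Prop) (K B c : ℕ) (h0 : I 0 M)
    (hstep : ∀ n M', Frame (.while b p) M M' → I n M' → b.Holds M' →
      n < K ∧ Total E f p M' fun M'' T N => I (n + 1) M'' ∧ T ≤ B ∧ N ≤ c) :
    Total E f (.while b p) M fun M' T N => Frame (.while b p) M M' ∧
      ∃ n ≤ K, I n M' ∧ ¬ b.Holds M' ∧ T ≤ n * (B + 1) + 1 ∧ N ≤ n * c := by
  suffices h : ∀ r n M', Frame (.while b p) M M' → I n M' → n ≤ K → K - n = r →
      ∃ M'' T N, Exec E f (.while b p) M' M'' T N ∧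
        ∃ n' ≤ K, n ≤ n' ∧ I n' M'' ∧ ¬ b.Holds M'' ∧ T ≤ (n' - n) * (B + 1) + 1 ∧
          N ≤ (n' - n) * c by
    obtain ⟨M', T, N, hE, n, hn, -, hI, hb, hT, hN⟩ := h _ 0 M (.refl _ _) h0 (Nat.zero_le _) rfl
    exact ⟨M', T, N, hE, hE.frame, n, hn, hI, hb, hT, hN⟩
  intro r
  induction r with
  | zero =>
    intro n M' hF hI hn hr
    by_cases hb : b.Holds M'
    · have := (hstep n M' hF hI hb).1
      omega
    · exact ⟨M', 1, 0, .whileDone hb, n, hn, le_rfl, hI, hb, by simp, by simp⟩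
  | succ r ih =>
    intro n M' hF hI hn hr
    by_cases hb : b.Holds M'
    · obtain ⟨hlt, M₁, T₁, N₁, hE₁, hI₁, hT₁, hN₁⟩ := hstep n M' hF hI hb
      have hF₁ : Frame (.while b p) M' M₁ := hE₁.frame.weaken (List.Subset.refl _)
        (List.Subset.refl _) (List.Subset.refl _)
      obtain ⟨M₂, T₂, N₂, hE₂, n', hn', hle, hI₂, hb₂, hT₂, hN₂⟩ :=
        ih (n + 1) M₁ (hF.trans hF₁) hI₁ hlt (by omega)
      refine ⟨M₂, _, _, .whileStep hb hE₁ hE₂, n', hn', by omega, hI₂, hb₂, ?_, ?_⟩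
      · rw [show n' - n = (n' - (n + 1)) + 1 by omega, Nat.succ_mul]
        omega
      · rw [show n' - n = (n' - (n + 1)) + 1 by omega, Nat.succ_mul]
        omega
    · exact ⟨M', 1, 0, .whileDone hb, n, hn, le_rfl, hI, hb, by simp, by simp⟩

end Total

/-- A computation without oracle calls does not depend on the objective. -/
theorem Exec.of_calls_eq_zero {E : Eigensolver} {d : ℕ} {f : (Fin d → ℝ) → EReal} {p : Program}
    {M M' : Memory} {T N : ℕ} (h : Exec E f p M M' T N) (hN : N = 0) (g : (Fin d → ℝ) → EReal) :
    Exec E g p M M' T N := by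
  induction h with
  | instr I M =>
    have : I.effect E f M = I.effect E g M := by
      cases I <;> first | rfl | simp [Instr.calls] at hN
    rw [this]
    exact .instr I M
  | seq _ _ ih1 ih2 => exact .seq (ih1 (by omega)) (ih2 (by omega))
  | iteTrue hb _ ih => exact .iteTrue hb (ih hN)
  | iteFalse hb _ ih => exact .iteFalse hb (ih hN)
  | whileDone hb => exact .whileDone hb
  | whileStep hb _ _ ih1 ih2 => exact .whileStep hb (ih1 (by omega)) (ih2 (by omega))

/-! ### The program -/

/-! Fixed registers for natural numbers: `0`, `1`, `2` hold the inputs `d`, `k` and `mono`, `3` and `4`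
the constants `1` and `0`, and `5` holds `min {d, k}`. Fixed registers for reals: `2` holds `0`,
`3` the budget `s`, and `4` the level. Array `1` is the result, array `2` holds `Q`, and row `0` of
array `3` holds `t`. -/

namespace Program

/-- Copies the register `j` for reals to `i`; the register `2` for reals holds `0`. -/
def copy (i j : ℕ) : Program := .instr (.realOp .add i j 2)

/-- Replaces the register `i` for reals by the maximum of the registers `i` and `j`. -/
def maxInto (i j : ℕ) : Program := .ite (.realLe i j) (copy i j) (copy i i)

/-- Replaces the register `i` for reals by the minimum of the registers `i` and `j`. -/
def minInto (i j : ℕ) : Program := .ite (.realLe i j) (copy i i) (copy i j)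

/-- The level `c(s)` is computed in register `4`, as the least of the averages
`(s + t₁ + ⋯ + t_i) / i` for `i ≤ min {d, k}`, in a single pass. -/
def computeLevel : Program := block [
  .instr (.load 5 3 4 4),
  .instr (.realOp .add 4 3 5),
  .instr (.setNat 6 1),
  .while (.natLt 6 5) (block [
    .instr (.load 6 3 4 6),
    .instr (.realOp .add 5 5 6),
    .instr (.natOp .add 6 6 3),
    .instr (.ofNat 7 6),
    .instr (.realOp .add 6 3 5),
    .instr (.realOp .div 6 6 7),
    minInto 4 6])]

/-- The point `t + β` for the level in register `4` is written to row `0` of array `4`. -/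
def computePoint : Program := block [
  .instr (.setNat 6 0),
  .while (.natLt 6 0) (block [
    .instr (.load 5 3 4 6),
    maxInto 5 4,
    .instr (.natOp .add 7 6 5),
    .ite (.natLt 7 0) (block [
      .instr (.load 6 3 4 7),
      minInto 5 6]) (block []),
    .instr (.store 4 4 6 5),
    .instr (.natOp .add 6 6 3)])]

/-- The value of the objective at `t + β(s)` is written to register `7`. -/
def evaluate : Program := block [
  computeLevel,
  computePoint,
  .instr (.query 4 7 8)]

/-- Ternary search for a budget `s`, in the interval between the registers `8` and `9`: the
registers `10`, `11` and `14` hold its length, `L` times its length, and `2 ε`. -/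
def search : Program := block [
  .instr (.ofNat 8 4),
  .instr (.ofNat 9 1),
  .instr (.realOp .add 14 1 1),
  .instr (.setNat 7 3),
  .instr (.ofNat 15 7),
  .instr (.realOp .sub 10 9 8),
  .instr (.realOp .mul 11 0 10),
  .while (.realLe 14 11) (block [
    .instr (.realOp .div 10 10 15),
    .instr (.realOp .add 12 8 10),
    .instr (.realOp .sub 13 9 10),
    copy 3 12,
    evaluate,
    copy 16 7,
    copy 3 13,
    evaluate,
    .ite (.realLe 16 7) (copy 9 13) (copy 8 12),
    .instr (.realOp .sub 10 9 8),
    .instr (.realOp .mul 11 0 10)]),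
  .instr (.realOp .add 10 9 8),
  .instr (.setNat 7 2),
  .instr (.ofNat 15 7),
  .instr (.realOp .div 3 10 15)]

/-- For the index `q` in register `9` for natural numbers, `β'_q` and its square root are written
to the registers `17` and `18`. -/
def loadWater : Program := block [
  .ite (.natLt 9 5) (block [
    .instr (.load 17 3 4 9),
    .instr (.realOp .sub 17 4 17),
    maxInto 17 2]) (copy 17 2),
  .instr (.sqrt 18 17)]

/-- The column `0` of array `1` is set to `√β'₀` times the first eigenvector; register `19` is its
squared length, and register `20` the target squared length `s / k`. -/
def initDesign : Program := block [
  .instr (.setNat 9 0),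
  loadWater,
  copy 19 17,
  .instr (.ofNat 20 1),
  .instr (.realOp .div 20 3 20),
  .instr (.setNat 6 0),
  .while (.natLt 6 0) (block [
    .instr (.load 21 2 6 4),
    .instr (.realOp .mul 21 18 21),
    .instr (.store 1 6 4 21),
    .instr (.natOp .add 6 6 3)]),
  .instr (.setNat 10 1),
  .instr (.natOp .add 11 1 4),
  .instr (.setNat 12 0),
  .instr (.setNat 13 1)]

/-- The rotation of column `n` of array `1` with `√β'_q` times the eigenvector `q`, where `q`, `n`,
`n + 1` are in the registers `9`, `12`, `13`; the cosine and the sine are in `22` and `23`. -/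
def rotateColumns : Program := block [
  .instr (.setNat 6 0),
  .while (.natLt 6 0) (block [
    .instr (.load 24 1 6 12),
    .instr (.load 25 2 6 9),
    .instr (.realOp .mul 25 18 25),
    .instr (.realOp .mul 26 22 24),
    .instr (.realOp .mul 27 23 25),
    .instr (.realOp .add 26 26 27),
    .instr (.store 1 6 12 26),
    .instr (.realOp .mul 26 22 25),
    .instr (.realOp .mul 27 23 24),
    .instr (.realOp .sub 26 26 27),
    .instr (.store 1 6 13 26),
    .instr (.natOp .add 6 6 3)])]

/-- The squared cosine `(b - m) / (b - a)`, for the values `a`, `b`, `m` in registers `19`, `17`,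
`20`. -/
def weightQuotient : Program := block [
  .instr (.realOp .sub 22 17 20),
  .instr (.realOp .sub 23 17 19),
  .instr (.realOp .div 22 22 23)]

/-- The cosine and the sine of the next rotation; equal lengths are treated separately, so that
there is no division by zero. -/
def computeAngle : Program := block [
  .ite (.realLe 19 17)
    (.ite (.realLe 17 19) (.instr (.ofNat 22 3)) weightQuotient)
    weightQuotient,
  .instr (.ofNat 23 3),
  .instr (.realOp .sub 23 23 22),
  .instr (.sqrt 22 22),
  .instr (.sqrt 23 23)]

/-- The choice of the next unused index `q`: the last one (the shortest vector) if the active column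
is too long, and the first one (the longest vector) if it is too short. -/
def choosePartner : Program :=
  .ite (.realLe 20 19)
    (block [.instr (.natOp .sub 11 11 3), .instr (.natOp .add 9 11 4)])
    (block [.instr (.natOp .add 9 10 4), .instr (.natOp .add 10 10 3)])

/-- The columns of array `1` are equalized one after the other. The rotations act on the columns of
`X = Q Z` and not on those of `Z`, since the product `Q Z` would take time `d² k`. -/
def equalize : Program :=
  .while (.natLt 13 1) (block [
    choosePartner,
    loadWater,
    computeAngle,
    rotateColumns,
    .instr (.realOp .add 19 19 17),
    .instr (.realOp .sub 19 19 20),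
    .instr (.natOp .add 12 12 3),
    .instr (.natOp .add 13 13 3)])

/-- The factorization step: array `1` is set to the design for the budget in register `3`. -/
def factorize : Program := block [
  computeLevel,
  initDesign,
  equalize]

/-- The eigendecomposition is written to the arrays `2` and `3`, the constants and `min {d, k}` to
registers. -/
def prepare : Program := block [
  .instr (.setNat 3 1),
  .instr (.setNat 4 0),
  .instr (.ofNat 2 4),
  .ite (.natLt 1 0) (.instr (.natOp .add 5 1 4)) (.instr (.natOp .add 5 0 4)),
  .instr (.eig 0 0 2 3)]

/-- The steps after the clearing of unused inputs: eigendecomposition, choice of the budget,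
factorization. -/
def solve : Program := block [
  prepare,
  .ite (.natLt 4 2) (.instr (.ofNat 3 1)) search,
  factorize]

/-- The spectral design algorithm. If the objective is declared to be non-increasing, the inputs `L`
and `ε` are erased first, so that the result visibly does not depend on them. -/
def spectralDesign : Program := block [
  .ite (.natLt 4 2) (block [.instr (.ofNat 0 4), .instr (.ofNat 1 4)]) (block []),
  solve]

end Program

open Total

/-! ### Specifications of the parts of the program -/

section
variable {E : Eigensolver} {d k : ℕ} {f : (Fin d → ℝ) → EReal} {M : Memory}
  {Q : Memory → ℕ → ℕ → Prop}

namespace Total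

theorem copy_of {i j : ℕ} (hz : M.real 2 = 0)
    (h : Q { M with real := Function.update M.real i (M.real j) } 1 0) :
    Total E f (.copy i j) M Q := by
  rw [Program.copy, instr_iff]
  simpa [Instr.effect, RealOp.eval, hz, Instr.time, Instr.calls] using h

theorem maxInto_of {i j : ℕ} (hz : M.real 2 = 0)
    (h : Q { M with real := Function.update M.real i (max (M.real i) (M.real j)) } 2 0) :
    Total E f (.maxInto i j) M Q := by
  refine ite_of (fun hb => copy_of hz ?_) fun hb => copy_of hz ?_
  · rwa [max_eq_right hb] at h
  · rwa [max_eq_left (not_le.1 hb).le] at h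

theorem minInto_of {i j : ℕ} (hz : M.real 2 = 0)
    (h : Q { M with real := Function.update M.real i (min (M.real i) (M.real j)) } 2 0) :
    Total E f (.minInto i j) M Q := by
  refine ite_of (fun hb => copy_of hz ?_) fun hb => copy_of hz ?_
  · rwa [min_eq_left hb] at h
  · rwa [min_eq_right (not_le.1 hb).le] at h

/-- Abstracts the current memory. -/
theorem generalize_memory {p : Program} (h : ∀ M', M' = M → Total E f p M' Q) :
    Total E f p M Q :=
  h M rfl

end Total

/-- The sizes and constants are in their registers. -/
structure Ready (d k : ℕ) (M : Memory) : Prop where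
  nat0 : M.nat 0 = d
  nat1 : M.nat 1 = k
  nat3 : M.nat 3 = 1
  nat4 : M.nat 4 = 0
  nat5 : M.nat 5 = min d k
  real2 : M.real 2 = 0

theorem Ready.of_frame {M' : Memory} {p : Program} (h : Ready d k M) (hF : Frame p M M')
    (hn : ∀ i ∈ [0, 1, 3, 4, 5], i ∉ p.natWrites) (hr : 2 ∉ p.realWrites) : Ready d k M' := by
  simp only [List.forall_mem_cons] at hn
  obtain ⟨h0, h1, h3, h4, h5, -⟩ := hn
  exact ⟨(hF.nat 0 h0).trans h.nat0, (hF.nat 1 h1).trans h.nat1, (hF.nat 3 h3).trans h.nat3,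
    (hF.nat 4 h4).trans h.nat4, (hF.nat 5 h5).trans h.nat5, (hF.real 2 hr).trans h.real2⟩

theorem Ready.effect (h : Ready d k M) (I : Instr)
    (hn : ∀ i ∈ [0, 1, 3, 4, 5], i ∉ (Program.instr I).natWrites := by decide)
    (hr : 2 ∉ (Program.instr I).realWrites := by decide) : Ready d k (I.effect E f M) :=
  h.of_frame (.instr I M) hn hr

/-! ### The computation of the level and of the point on the path -/

theorem IsLeastAverage.succ {τ : ℕ → ℝ} {n : ℕ} {s c : ℝ} (h : IsLeastAverage τ n s c) :
    IsLeastAverage τ (n + 1) s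
      (min c ((s + ∑ j ∈ Finset.range (n + 1), τ j) / (n + 1 : ℕ))) := by
  have : Set.Icc 1 (n + 1) = insert (n + 1) (Set.Icc 1 n) := by
    ext i
    simp only [Set.mem_Icc, Set.mem_insert_iff]
    omega
  rw [IsLeastAverage, this, Set.image_insert_eq, min_comm]
  exact h.insert _

theorem computeLevel_spec (hM : Ready d k M) (hn : 1 ≤ min d k) :
    Total E f .computeLevel M fun M' T N => Frame .computeLevel M M' ∧
      IsLeastAverage (M.arr 3 0) (min d k) (M.real 3) (M'.real 4) ∧ T ≤ 15 * d ∧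
      N = 0 := by
  apply Total.frame
  unfold Program.computeLevel
  simp only [block_cons_iff, instr_iff]
  refine (while_of (fun i M' => i + 1 ≤ min d k ∧ M'.nat 6 = i + 1 ∧
    M'.real 5 = ∑ j ∈ Finset.range (i + 1), M.arr 3 0 j ∧
    IsLeastAverage (M.arr 3 0) (i + 1) (M.real 3) (M'.real 4)) (min d k) 10 0 ?_ ?_).mono ?_
  · simp [Instr.effect, RealOp.eval, hM.nat4, hn, IsLeastAverage]
  · rintro i M' hF ⟨hin, h6, hr5, hc⟩ hb
    have hM' : Ready d k M' := Ready.of_frame (((hM.effect _).effect _).effect _) hF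
      (by decide) (by decide)
    have as : M'.real 3 = M.real 3 := hF.real 3 (by decide)
    have at3 : M'.arr 3 = M.arr 3 := hF.arr 3 (by decide)
    simp only [Test.Holds, hM'.nat5, h6] at hb
    refine ⟨by omega, ?_⟩
    have hsucc := hc.succ
    rw [Finset.sum_range_succ, ← hr5] at hsucc
    simp only [block_cons_iff, instr_iff]
    refine minInto_of (by simp [Instr.effect, hM'.real2]) ?_
    simp [block_nil_iff, Instr.effect, RealOp.eval, NatOp.eval, hM'.nat3, hM'.nat4, h6, as, at3,
      Instr.time, Instr.calls, Finset.sum_range_succ _ (i + 1), hr5] at hsucc ⊢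
    exact ⟨by omega, hsucc⟩
  · rintro M' T N ⟨hF, i, hi, ⟨hin, h6, hr5, hc⟩, hb, hT, hN⟩
    have a5 : M'.nat 5 = min d k := (hF.nat 5 (by decide)).trans hM.nat5
    simp only [Test.Holds, a5, h6, not_lt] at hb
    have hid : i + 1 = min d k := by omega
    simp only [block_nil_iff, Instr.time, Instr.calls]
    refine ⟨hid ▸ hc, by omega, by omega⟩

theorem computePoint_spec (hM : Ready d k M) :
    Total E f .computePoint M fun M' T N => Frame .computePoint M M' ∧
      (∀ j < d, M'.arr 4 0 j = if j + min d k < d then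
        min (max (M.real 4) (M.arr 3 0 j)) (M.arr 3 0 (j + min d k))
        else max (M.real 4) (M.arr 3 0 j)) ∧ T ≤ 16 * d + 10 ∧ N = 0 := by
  apply Total.frame
  unfold Program.computePoint
  simp only [block_cons_iff, instr_iff]
  refine (while_of (fun i M' => i ≤ d ∧ M'.nat 6 = i ∧
    ∀ j < i, M'.arr 4 0 j = if j + min d k < d then
        min (max (M.real 4) (M.arr 3 0 j)) (M.arr 3 0 (j + min d k))
        else max (M.real 4) (M.arr 3 0 j)) d 15 0 ?_ ?_).mono ?_
  · simp [Instr.effect]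
  · rintro i M' hF ⟨hin, h6, hp⟩ hb
    have hM' : Ready d k M' := Ready.of_frame (hM.effect _) hF (by decide) (by decide)
    have ac : M'.real 4 = M.real 4 := hF.real 4 (by decide)
    have at3 : M'.arr 3 = M.arr 3 := hF.arr 3 (by decide)
    simp only [Test.Holds, hM'.nat0, h6] at hb
    refine ⟨by omega, ?_⟩
    simp only [block_cons_iff, instr_iff]
    refine maxInto_of (by simp [Instr.effect, hM'.real2]) ?_
    have hclose : ∀ v, (v = if i + min d k < d then
        min (max (M.real 4) (M.arr 3 0 i)) (M.arr 3 0 (i + min d k))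
        else max (M.real 4) (M.arr 3 0 i)) → ∀ j ≤ i,
        (if j = i then v else M'.arr 4 0 j) = if j + min d k < d then
        min (max (M.real 4) (M.arr 3 0 j)) (M.arr 3 0 (j + min d k))
        else max (M.real 4) (M.arr 3 0 j) := by
      rintro v rfl j hj
      split
      · subst j; rfl
      · exact hp j (by omega)
    refine ite_of (fun h => ?_) fun h => ?_
    · simp only [block_cons_iff, instr_iff]
      refine minInto_of (by simp [Instr.effect, hM'.real2]) ?_
      simp [Test.Holds, Instr.effect, NatOp.eval, h6, hM'.nat5, hM'.nat0] at h
      simp [block_nil_iff, Instr.effect, NatOp.eval, hM'.nat3, hM'.nat4, hM'.nat5, h6, ac, at3,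
        Instr.time, Instr.calls, Memory.setEntry]
      refine ⟨hb, hclose _ ?_⟩
      rw [if_pos h, max_comm]
    · simp [Test.Holds, Instr.effect, NatOp.eval, h6, hM'.nat5, hM'.nat0] at h
      simp [block_nil_iff, Instr.effect, NatOp.eval, hM'.nat3, hM'.nat4, hM'.nat5, h6, ac, at3,
        Instr.time, Instr.calls, Memory.setEntry]
      refine ⟨hb, hclose _ ?_⟩
      rw [if_neg (by omega), max_comm]
  · rintro M' T N ⟨hF, i, hi, ⟨hin, h6, hp⟩, hb, hT, hN⟩
    have a5 : M'.nat 0 = d := (hF.nat 0 (by decide)).trans hM.nat0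
    simp only [Test.Holds, a5, h6, not_lt] at hb
    obtain rfl : i = d := by omega
    simp only [block_nil_iff, Instr.time, Instr.calls]
    refine ⟨hp, by omega, by omega⟩

theorem computePoint_eq {t : Fin d → ℝ} {τ : ℕ → ℝ} (hτ : ∀ j : Fin d, t j = τ j) (c : ℝ)
    (j : Fin d) : (if (j : ℕ) + min d k < d then min (max c (τ j)) (τ (j + min d k))
      else max c (τ j)) = (t + fill t k c) j := by
  rw [Pi.add_apply, add_fill]
  split <;> simp [hτ]

theorem evaluate_spec [NeZero d] [NeZero k] (hM : Ready d k M) {t : Fin d → ℝ} (ht : Monotone t)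
    (hτ : ∀ j : Fin d, t j = M.arr 3 0 j) (hs : 0 ≤ M.real 3) :
    Total E f .evaluate M fun M' T N => Frame .evaluate M M' ∧
      M'.real 7 = (f (t + beta t k (M.real 3))).toReal ∧ T ≤ 50 * d ∧ N = 1 := by
  apply Total.frame
  unfold Program.evaluate
  have hd : 1 ≤ d := (one_le_min_neZero d k).trans (min_le_left _ _)
  rw [block_cons_iff]
  refine (computeLevel_spec hM (one_le_min_neZero d k)).mono ?_
  rintro M₁ T₁ N₁ ⟨hF₁, hc, hT₁, rfl⟩
  have hM₁ : Ready d k M₁ := hM.of_frame hF₁ (by decide) (by decide)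
  have hlev := hc.level_eq ht hτ hs
  rw [block_cons_iff]
  refine (computePoint_spec hM₁).mono ?_
  rintro M₂ T₂ N₂ ⟨hF₂, hp, hT₂, rfl⟩
  have hpt : (fun j : Fin d => M₂.arr 4 0 j) = t + beta t k (M.real 3) := by
    funext j
    rw [hp j j.isLt, hF₁.arr 3 (by decide), computePoint_eq hτ, beta, hlev]
  have h4 : M₂.nat 4 = 0 := (hM₁.of_frame hF₂ (by decide) (by decide)).nat4
  simp only [block_cons_iff, block_nil_iff, instr_iff]
  refine ⟨?_, ?_, ?_⟩
  · simp [Instr.effect, hpt]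
  · simp only [Instr.time]
    omega
  · simp [Instr.calls]

end
/-! ### The search for the budget -/

/-- An upper bound for the number of steps of the ternary search, for `x = k L / ε`. No step, and so
no oracle call, is made for `x < 2`, where the midpoint of `[0, k]` is an `ε`-optimal budget by the
Lipschitz condition alone. -/
noncomputable def searchSteps (x : ℝ) : ℕ :=
  if x < 2 then 0 else ⌊Real.log x / Real.log (3 / 2)⌋₊ + 1

theorem lt_searchSteps {x : ℝ} {n : ℕ} (h : 2 ≤ x * (2 / 3) ^ n) : n < searchSteps x := by
  have hx0 : 0 < x := by
    by_contra hx
    have : x * (2 / 3) ^ n ≤ 0 := mul_nonpos_of_nonpos_of_nonneg (not_lt.1 hx) (by positivity)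
    linarith
  have hx : 2 ≤ x :=
    h.trans (mul_le_of_le_one_right hx0.le (pow_le_one₀ (by norm_num) (by norm_num)))
  rw [searchSteps, if_neg (not_lt.2 hx), Nat.lt_succ_iff]
  refine Nat.le_floor ((le_div_iff₀ (Real.log_pos (by norm_num))).2 ?_)
  rw [← Real.log_pow]
  refine Real.log_le_log (by positivity) ?_
  have h1 : ((3 : ℝ) / 2) ^ n * (2 / 3) ^ n = 1 := by rw [← mul_pow]; norm_num
  have h2 : (0 : ℝ) < (2 / 3) ^ n := by positivity
  refine le_of_mul_le_mul_right ?_ h2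
  rw [h1]
  linarith

/-- The constant in the bound for the number of steps of the ternary search. -/
noncomputable def searchConst : ℝ := 1 / Real.log (3 / 2) + 1 / Real.log 2

theorem searchConst_pos : 0 < searchConst :=
  add_pos (one_div_pos.2 (Real.log_pos (by norm_num))) (one_div_pos.2 (Real.log_pos (by norm_num)))

theorem searchSteps_le (x : ℝ) : (searchSteps x : ℝ) ≤ searchConst * max 0 (Real.log x) := by
  unfold searchSteps
  split_ifs with hx
  · simp only [Nat.cast_zero]
    exact mul_nonneg searchConst_pos.le (le_max_left _ _)
  · have hx : 2 ≤ x := not_lt.1 hx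
    have h2 : Real.log 2 ≤ Real.log x := Real.log_le_log (by norm_num) hx
    have h20 : 0 < Real.log 2 := Real.log_pos (by norm_num)
    have h32 : 0 < Real.log (3 / 2) := Real.log_pos (by norm_num)
    have h3 : (⌊Real.log x / Real.log (3 / 2)⌋₊ : ℝ) ≤ Real.log x / Real.log (3 / 2) :=
      Nat.floor_le (div_nonneg (h20.le.trans h2) h32.le)
    have h4 : 1 ≤ Real.log x / Real.log 2 := (one_le_div h20).2 h2
    rw [max_eq_right (h20.le.trans h2), searchConst, add_mul, one_div_mul_eq_div,
      one_div_mul_eq_div]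
    push_cast
    linarith

section
variable {E : Eigensolver} {d k : ℕ} {f : (Fin d → ℝ) → EReal} {M : Memory}

/-- The invariant of the search is that every budget in `[0, k]` is at least as costly as some
budget in the current interval. Its length is `k (2/3) ^ n` after `n` steps, and the midpoint is
returned as soon as half the length times `L` is less than `ε`. -/
theorem search_spec [NeZero d] [NeZero k] (hM : Ready d k M) {t : Fin d → ℝ} (ht : Monotone t)
    (hτ : ∀ j : Fin d, t j = M.arr 3 0 j) {L ε : ℝ} (hL : M.real 0 = L) (hε : M.real 1 = ε)
    (hL0 : 0 < L) (hε0 : 0 < ε) {G : ℝ → ℝ} (hGdef : G = fun s => (f (t + beta t k s)).toReal)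
    (hG : ConvexOn ℝ (Set.Icc 0 (k : ℝ)) G)
    (hlip : ∀ s ∈ Set.Icc (0 : ℝ) k, ∀ s' ∈ Set.Icc (0 : ℝ) k, |G s - G s'| ≤ L * |s - s'|) :
    Total E f .search M fun M' T N => Frame .search M M' ∧
      (M'.real 3 ∈ Set.Icc (0 : ℝ) k ∧ ∀ s' ∈ Set.Icc (0 : ℝ) k, G (M'.real 3) ≤ G s' + ε) ∧
      T ≤ 150 * d * (searchSteps (k * L / ε) + 1) ∧ N ≤ searchSteps (k * L / ε) * 2 := by
  apply Total.frame
  have hd : 1 ≤ d := (one_le_min_neZero d k).trans (min_le_left _ _)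
  unfold Program.search
  simp only [block_cons_iff, instr_iff]
  refine (while_of (fun n M' => 0 ≤ M'.real 8 ∧ M'.real 9 ≤ k ∧
    M'.real 9 - M'.real 8 = k * (2 / 3) ^ n ∧ M'.real 10 = M'.real 9 - M'.real 8 ∧
    M'.real 11 = L * (M'.real 9 - M'.real 8) ∧
    ∀ s' ∈ Set.Icc (0 : ℝ) k, ∃ s'' ∈ Set.Icc (M'.real 8) (M'.real 9), G s'' ≤ G s')
    (searchSteps (k * L / ε)) (120 * d) 2 ?_ ?_).mono ?_
  · simp [Instr.effect, RealOp.eval, hM.nat1, hM.nat4, hL]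
    exact fun s' h0 h1 => ⟨s', ⟨h0, h1⟩, le_rfl⟩
  · rintro n M' hF ⟨hlo, hhi, hw, h10, h11, hmin⟩ hb
    have hM' : Ready d k M' := Ready.of_frame
      (((((((hM.effect _).effect _).effect _).effect _).effect _).effect _).effect _) hF
      (by decide) (by decide)
    have aL : M'.real 0 = L := (hF.real 0 (by decide)).trans hL
    have a14 : M'.real 14 = ε + ε := by
      have := hF.real 14 (by decide)
      simpa [Instr.effect, RealOp.eval, hε] using this
    have a15 : M'.real 15 = 3 := by
      have := hF.real 15 (by decide)
      simpa [Instr.effect] using this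
    have at3 : M'.arr 3 = M.arr 3 := hF.arr 3 (by decide)
    simp only [Test.Holds, a14, h11, hw] at hb
    refine ⟨lt_searchSteps ?_, ?_⟩
    · -- the loop condition bounds the number of steps
      rw [div_mul_eq_mul_div, le_div_iff₀ hε0]
      linarith
    generalize hlo' : M'.real 8 = lo at *
    generalize hhi' : M'.real 9 = hi at *
    have hw0 : 0 < hi - lo := by rw [hw]; have := NeZero.pos k; positivity
    simp only [block_cons_iff, instr_iff]
    -- evaluation at the first inner point
    refine copy_of (by simp [Instr.effect, hM'.real2]) (generalize_memory fun B hB => ?_)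
    have hBr : Ready d k B := by
      constructor <;> simp [hB, Instr.effect, hM'.nat0, hM'.nat1, hM'.nat3, hM'.nat4, hM'.nat5,
        hM'.real2]
    have hBt : B.arr 3 = M.arr 3 := by simp [hB, Instr.effect, at3]
    have b0 : B.real 0 = L := by simp [hB, Instr.effect, aL]
    have b3 : B.real 3 = lo + (hi - lo) / 3 := by
      simp [hB, Instr.effect, RealOp.eval, h10, a15, hlo']
    have b8 : B.real 8 = lo := by simp [hB, Instr.effect, hlo']
    have b9 : B.real 9 = hi := by simp [hB, Instr.effect, hhi']
    have b12 : B.real 12 = lo + (hi - lo) / 3 := by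
      simp [hB, Instr.effect, RealOp.eval, h10, a15, hlo']
    have b13 : B.real 13 = hi - (hi - lo) / 3 := by
      simp [hB, Instr.effect, RealOp.eval, h10, a15, hhi']
    clear hB
    refine (evaluate_spec hBr ht (by rw [hBt]; exact hτ) (by rw [b3]; positivity)).mono ?_
    rintro M₁ T₁ N₁ ⟨hF₁, hv₁, hT₁, rfl⟩
    have hM₁ : Ready d k M₁ := hBr.of_frame hF₁ (by decide) (by decide)
    -- evaluation at the second inner point
    refine copy_of hM₁.real2 (copy_of (by simp [hM₁.real2]) (generalize_memory fun D hD => ?_))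
    have hDr : Ready d k D := by
      constructor <;> simp [hD, hM₁.nat0, hM₁.nat1, hM₁.nat3, hM₁.nat4, hM₁.nat5, hM₁.real2]
    have hDt : D.arr 3 = M.arr 3 := by simp [hD, ← hBt, hF₁.arr 3 (by decide)]
    have d0 : D.real 0 = L := by simp [hD, ← b0, hF₁.real 0 (by decide)]
    have d3 : D.real 3 = hi - (hi - lo) / 3 := by simp [hD, ← b13, hF₁.real 13 (by decide)]
    have d8 : D.real 8 = lo := by simp [hD, ← b8, hF₁.real 8 (by decide)]
    have d9 : D.real 9 = hi := by simp [hD, ← b9, hF₁.real 9 (by decide)]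
    have d12 : D.real 12 = lo + (hi - lo) / 3 := by simp [hD, ← b12, hF₁.real 12 (by decide)]
    have d13 : D.real 13 = hi - (hi - lo) / 3 := by simp [hD, ← b13, hF₁.real 13 (by decide)]
    have d16 : D.real 16 = G (lo + (hi - lo) / 3) := by simp [hD, hv₁, hGdef, b3]
    clear hD
    refine (evaluate_spec hDr ht (by rw [hDt]; exact hτ) (by rw [d3]; linarith)).mono ?_
    rintro M₂ T₂ N₂ ⟨hF₂, hv₂, hT₂, rfl⟩
    have hM₂ : Ready d k M₂ := hDr.of_frame hF₂ (by decide) (by decide)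
    have e0 : M₂.real 0 = L := (hF₂.real 0 (by decide)).trans d0
    have e8 : M₂.real 8 = lo := (hF₂.real 8 (by decide)).trans d8
    have e9 : M₂.real 9 = hi := (hF₂.real 9 (by decide)).trans d9
    have e12 := (hF₂.real 12 (by decide)).trans d12
    have e13 := (hF₂.real 13 (by decide)).trans d13
    have e16 := (hF₂.real 16 (by decide)).trans d16
    have e7 : M₂.real 7 = G (hi - (hi - lo) / 3) := by rw [hv₂, d3, hGdef]
    have hp : lo + (hi - lo) / 3 ∈ Set.Icc (0 : ℝ) k := ⟨by positivity, by linarith⟩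
    have hq : hi - (hi - lo) / 3 ∈ Set.Icc (0 : ℝ) k := ⟨by linarith, by linarith⟩
    refine ite_of (fun h => copy_of hM₂.real2 ?_) fun h => copy_of hM₂.real2 ?_
    · simp only [Test.Holds, e16, e7] at h
      simp [block_nil_iff, Instr.effect, RealOp.eval, Instr.time, Instr.calls, e0, e8, e13]
      refine ⟨⟨hlo, by linarith, by rw [pow_succ]; linarith, fun s' h0 h1 => ?_⟩, by omega⟩
      obtain ⟨z, hz, hzle⟩ := hmin s' ⟨h0, h1⟩
      rcases le_or_gt z (hi - (hi - lo) / 3) with hzq | hzq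
      · exact ⟨z, ⟨hz.1, hzq⟩, hzle⟩
      · refine ⟨hi - (hi - lo) / 3, ⟨by linarith, le_rfl⟩, le_trans ?_ hzle⟩
        exact hG.le_right_of_left_le'' hp ⟨hlo.trans hz.1, hz.2.trans hhi⟩ (by linarith) hzq.le h
    · simp only [Test.Holds, e16, e7, not_le] at h
      simp [block_nil_iff, Instr.effect, RealOp.eval, Instr.time, Instr.calls, e0, e9, e12]
      refine ⟨⟨hp.1, hhi, by rw [pow_succ]; linarith, fun s' h0 h1 => ?_⟩, by omega⟩
      obtain ⟨z, hz, hzle⟩ := hmin s' ⟨h0, h1⟩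
      rcases le_or_gt (lo + (hi - lo) / 3) z with hzq | hzq
      · exact ⟨z, ⟨hzq, hz.2⟩, hzle⟩
      · refine ⟨lo + (hi - lo) / 3, ⟨le_rfl, by linarith⟩, le_trans ?_ hzle⟩
        exact hG.le_left_of_right_le'' ⟨hlo.trans hz.1, hz.2.trans hhi⟩ hq hzq.le (by linarith) h.le
  · rintro M' T N ⟨hF, n, hn, ⟨hlo, hhi, hw, h10, h11, hmin⟩, hb, hT, hN⟩
    have a14 : M'.real 14 = ε + ε := by
      have := hF.real 14 (by decide)
      simpa [Instr.effect, RealOp.eval, hε] using this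
    simp only [Test.Holds, a14, h11, not_le] at hb
    simp [block_nil_iff, Instr.effect, RealOp.eval, Instr.time, Instr.calls]
    generalize M'.real 8 = lo at *
    generalize M'.real 9 = hi at *
    have hw0 : 0 < hi - lo := by rw [hw]; have := NeZero.pos k; positivity
    have hs : (hi + lo) / 2 ∈ Set.Icc (0 : ℝ) k := ⟨by linarith, by linarith⟩
    refine ⟨⟨hs, fun s' h0 h1 => ?_⟩, ?_, ?_⟩
    · obtain ⟨z, hz, hzle⟩ := hmin s' ⟨h0, h1⟩
      have h1 := (le_abs_self _).trans (hlip _ hs z ⟨hlo.trans hz.1, hz.2.trans hhi⟩)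
      have h2 : |(hi + lo) / 2 - z| ≤ (hi - lo) / 2 :=
        abs_le.2 ⟨by linarith [hz.2], by linarith [hz.1]⟩
      have h3 := mul_le_mul_of_nonneg_left h2 hL0.le
      linarith
    · generalize searchSteps (k * L / ε) = K at *
      have : n * (120 * d + 1) ≤ K * (120 * d + 1) := Nat.mul_le_mul_right _ hn
      nlinarith [Nat.zero_le K, Nat.mul_le_mul_left K hd]
    · exact hN.trans (Nat.mul_le_mul_right _ hn)

end

/-! ### The factorization -/

section
variable {E : Eigensolver} {d k : ℕ} {f : (Fin d → ℝ) → EReal} {M : Memory}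

/-- The entries of `β'` for the ground levels `τ`, continued by zeros. -/
noncomputable def water (n : ℕ) (c : ℝ) (τ : ℕ → ℝ) (q : ℕ) : ℝ :=
  if q < n then max (c - τ q) 0 else 0

theorem water_nonneg (n : ℕ) (c : ℝ) (τ : ℕ → ℝ) (q : ℕ) : 0 ≤ water n c τ q := by
  unfold water
  split
  · exact le_max_right _ _
  · exact le_rfl

theorem loadWater_spec (hM : Ready d k M) :
    Total E f .loadWater M fun M' T N => Frame .loadWater M M' ∧
      M'.real 17 = water (min d k) (M.real 4) (M.arr 3 0) (M.nat 9) ∧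
      M'.real 18 = √(M'.real 17) ∧ T ≤ 8 ∧ N = 0 := by
  apply Total.frame
  unfold Program.loadWater
  simp only [block_cons_iff]
  refine ite_of (fun h => ?_) fun h => copy_of hM.real2 ?_
  · simp only [block_cons_iff, instr_iff]
    refine maxInto_of (by simp [Instr.effect, hM.real2]) ?_
    simp only [Test.Holds, hM.nat5] at h
    simp [block_nil_iff, Instr.effect, RealOp.eval, Instr.time, Instr.calls, hM.nat4,
      hM.real2, water, h]
  · simp only [Test.Holds, hM.nat5] at h
    simp [block_nil_iff, instr_iff, Instr.effect, Instr.time, Instr.calls, hM.real2, water, h]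

theorem computeAngle_spec (hM : Ready d k M) :
    Total E f .computeAngle M fun M' T N => Frame .computeAngle M M' ∧
      M'.real 22 = √(rotationWeight (M.real 19) (M.real 17) (M.real 20)) ∧
      M'.real 23 = √(1 - rotationWeight (M.real 19) (M.real 17) (M.real 20)) ∧ T ≤ 12 ∧ N = 0 := by
  apply Total.frame
  unfold Program.computeAngle Program.weightQuotient
  simp only [block_cons_iff]
  refine ite_of (fun h => ite_of (fun h' => ?_) fun h' => ?_) fun h => ?_
  · have hab : M.real 19 = M.real 17 := le_antisymm h h'
    simp [block_nil_iff, instr_iff, Instr.effect, RealOp.eval, Instr.time,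
      Instr.calls, hM.nat3, rotationWeight, hab]
  · have hab : M.real 19 ≠ M.real 17 := fun e => h' e.symm.le
    simp [block_nil_iff, block_cons_iff, instr_iff, Instr.effect, RealOp.eval, Instr.time,
      Instr.calls, hM.nat3, rotationWeight, hab]
  · have hab : M.real 19 ≠ M.real 17 := fun e => h e.le
    simp [block_nil_iff, block_cons_iff, instr_iff, Instr.effect, RealOp.eval, Instr.time,
      Instr.calls, hM.nat3, rotationWeight, hab]

theorem rotateColumns_spec [NeZero d] (hM : Ready d k M) {n : ℕ} (h12 : M.nat 12 = n)
    (h13 : M.nat 13 = n + 1) :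
    Total E f .rotateColumns M fun M' T N => Frame .rotateColumns M M' ∧
      ((∀ r, ∀ c < n, M'.arr 1 r c = M.arr 1 r c) ∧
      (∀ r < d, M'.arr 1 r n =
        M.real 22 * M.arr 1 r n + M.real 23 * (M.real 18 * M.arr 2 r (M.nat 9))) ∧
      ∀ r < d, M'.arr 1 r (n + 1) =
        M.real 22 * (M.real 18 * M.arr 2 r (M.nat 9)) - M.real 23 * M.arr 1 r n) ∧
      T ≤ 20 * d ∧ N = 0 := by
  apply Total.frame
  unfold Program.rotateColumns
  simp only [block_cons_iff, instr_iff]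
  refine (while_of (fun i M' => i ≤ d ∧ M'.nat 6 = i ∧
      (∀ r, ∀ c < n, M'.arr 1 r c = M.arr 1 r c) ∧
      (∀ r < i, M'.arr 1 r n =
        M.real 22 * M.arr 1 r n + M.real 23 * (M.real 18 * M.arr 2 r (M.nat 9))) ∧
      (∀ r < i, M'.arr 1 r (n + 1) =
        M.real 22 * (M.real 18 * M.arr 2 r (M.nat 9)) - M.real 23 * M.arr 1 r n) ∧
      ∀ r, i ≤ r → M'.arr 1 r n = M.arr 1 r n) d 13 0 ?_ ?_).mono ?_
  · simp [Instr.effect]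
  · rintro i M' hF ⟨hin, h6, h0, h1, h2, h3⟩ hb
    have hM' : Ready d k M' := Ready.of_frame (hM.effect _) hF (by decide) (by decide)
    have a9 : M'.nat 9 = M.nat 9 := hF.nat 9 (by decide)
    have a12 : M'.nat 12 = n := (hF.nat 12 (by decide)).trans h12
    have a13 : M'.nat 13 = n + 1 := (hF.nat 13 (by decide)).trans h13
    have a18 : M'.real 18 = M.real 18 := hF.real 18 (by decide)
    have a22 : M'.real 22 = M.real 22 := hF.real 22 (by decide)
    have a23 : M'.real 23 = M.real 23 := hF.real 23 (by decide)
    have at2 : M'.arr 2 = M.arr 2 := hF.arr 2 (by decide)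
    simp only [Test.Holds, hM'.nat0, h6] at hb
    refine ⟨by omega, ?_⟩
    simp [block_cons_iff, instr_iff, block_nil_iff, Instr.effect, RealOp.eval, NatOp.eval, hM'.nat3,
      h6, a9, a12, a13, a18, a22, a23, at2, Instr.time, Instr.calls, Memory.setEntry]
    refine ⟨hb, fun r c hc => ?_, fun r hr => ?_, fun r hr => ?_, fun r hr => ?_⟩
    · rw [if_neg (by omega), if_neg (by omega)]
      exact h0 r c hc
    · split_ifs with h
      · rw [h, h3 i le_rfl]
      · exact h1 r (by omega)
    · split_ifs with h
      · rw [h, h3 i le_rfl]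
      · exact h2 r (by omega)
    · rw [if_neg (by omega)]
      exact h3 r hr.le
  · rintro M' T N ⟨hF, i, hi, ⟨hin, h6, h0, h1, h2, h3⟩, hb, hT, hN⟩
    have a0 : M'.nat 0 = d := (hF.nat 0 (by decide)).trans hM.nat0
    simp only [Test.Holds, a0, h6, not_lt] at hb
    have hd := NeZero.pos d
    obtain rfl : i = d := by omega
    simp only [block_nil_iff, Instr.time, Instr.calls]
    exact ⟨⟨h0, h1, h2⟩, by omega, by omega⟩

theorem initDesign_spec [NeZero d] (hM : Ready d k M) :
    Total E f .initDesign M fun M' T N => Frame .initDesign M M' ∧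
      ((M'.nat 10 = 1 ∧ M'.nat 11 = k ∧ M'.nat 12 = 0 ∧ M'.nat 13 = 1) ∧
      M'.real 19 = water (min d k) (M.real 4) (M.arr 3 0) 0 ∧ M'.real 20 = M.real 3 / k ∧
      ∀ r < d, M'.arr 1 r 0 =
        √(water (min d k) (M.real 4) (M.arr 3 0) 0) * M.arr 2 r 0) ∧ T ≤ 30 * d ∧ N = 0 := by
  apply Total.frame
  have hd := NeZero.pos d
  unfold Program.initDesign
  rw [block_cons_iff, instr_iff, block_cons_iff]
  refine (loadWater_spec (hM.effect _)).mono ?_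
  rintro M₁ T₁ N₁ ⟨hF₁, h17, h18, hT₁, rfl⟩
  have hM₁ : Ready d k M₁ := Ready.of_frame (hM.effect _) hF₁ (by decide) (by decide)
  have a3 : M₁.real 3 = M.real 3 := hF₁.real 3 (by decide)
  have at2 : M₁.arr 2 = M.arr 2 := hF₁.arr 2 (by decide)
  simp only [Instr.effect, Function.update_self] at h17
  rw [h17] at h18
  rw [block_cons_iff]
  refine copy_of hM₁.real2 (generalize_memory fun B hB => ?_)
  have hBr : Ready d k B := by
    constructor <;> simp [hB, hM₁.nat0, hM₁.nat1, hM₁.nat3, hM₁.nat4, hM₁.nat5, hM₁.real2]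
  have b19 : B.real 19 = water (min d k) (M.real 4) (M.arr 3 0) 0 := by simp [hB, h17]
  have b18 : B.real 18 = √(water (min d k) (M.real 4) (M.arr 3 0) 0) := by simp [hB, h18]
  have b3 : B.real 3 = M.real 3 := by simp [hB, a3]
  have bt2 : B.arr 2 = M.arr 2 := by simp [hB, at2]
  clear hB
  simp only [block_cons_iff, instr_iff]
  refine (while_of (fun i M' => i ≤ d ∧ M'.nat 6 = i ∧ ∀ r < i, M'.arr 1 r 0 =
      √(water (min d k) (M.real 4) (M.arr 3 0) 0) * M.arr 2 r 0) d 5 0 ?_ ?_).mono ?_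
  · simp [Instr.effect]
  · rintro i M' hF ⟨hin, h6, h0⟩ hb
    have hM' : Ready d k M' :=
      Ready.of_frame (((hBr.effect _).effect _).effect _) hF (by decide) (by decide)
    have c18 : M'.real 18 = B.real 18 := hF.real 18 (by decide)
    have ct2 : M'.arr 2 = B.arr 2 := hF.arr 2 (by decide)
    simp only [Test.Holds, hM'.nat0, h6] at hb
    refine ⟨by omega, ?_⟩
    simp [block_cons_iff, instr_iff, block_nil_iff, Instr.effect, RealOp.eval, NatOp.eval, hM'.nat3,
      hM'.nat4, h6, c18, b18, ct2, bt2, Instr.time, Instr.calls, Memory.setEntry]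
    refine ⟨hb, fun r hr => ?_⟩
    split_ifs with h
    · rw [h]
    · exact h0 r (by omega)
  · rintro M' T N ⟨hF, i, hi, ⟨hin, h6, h0⟩, hb, hT, hN⟩
    have c0 : M'.nat 0 = d := (hF.nat 0 (by decide)).trans hBr.nat0
    have c1 : M'.nat 1 = k := (hF.nat 1 (by decide)).trans hBr.nat1
    have c4 : M'.nat 4 = 0 := (hF.nat 4 (by decide)).trans hBr.nat4
    have c19 : M'.real 19 = B.real 19 := hF.real 19 (by decide)
    have c20 : M'.real 20 = M.real 3 / k := by
      have := hF.real 20 (by decide)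
      simpa [Instr.effect, RealOp.eval, b3, hBr.nat1] using this
    simp only [Test.Holds, c0, h6, not_lt] at hb
    obtain rfl : i = d := by omega
    simp [block_nil_iff, Instr.effect, NatOp.eval, Instr.time, Instr.calls, c1, c4, c19, b19, c20]
    exact ⟨h0, by omega, by omega⟩

theorem choosePartner_spec (hM : Ready d k M) {n lo hi : ℕ} {y : Fin d → ℕ → ℝ} {b : ℕ → ℝ}
    {X : Fin d → ℕ → ℝ} (h10 : M.nat 10 = lo) (h11 : M.nat 11 = hi) (hlt : lo < hi)
    (hb : ∀ i j, i ≤ j → j < k → b j ≤ b i)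
    (hX : IsPartialBalancing y b (M.real 20) k n lo hi X (M.real 19)) :
    Total E f .choosePartner M fun M' T N => Frame .choosePartner M M' ∧
      ((M'.nat 9 = lo ∧ M'.nat 10 = lo + 1 ∧ M'.nat 11 = hi ∨
        M'.nat 9 = hi - 1 ∧ M'.nat 10 = lo ∧ M'.nat 11 = hi - 1) ∧
      (M.real 19 ≤ M.real 20 ∧ M.real 20 ≤ b (M'.nat 9) ∨
        b (M'.nat 9) ≤ M.real 20 ∧ M.real 20 ≤ M.real 19)) ∧ T ≤ 4 ∧ N = 0 := by
  apply Total.frame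
  unfold Program.choosePartner
  refine ite_of (fun h => ?_) fun h => ?_
  · have := hX.le_of_le_active hlt hb h
    simp [block_cons_iff, instr_iff, block_nil_iff, Instr.effect, NatOp.eval, hM.nat3, hM.nat4, h10,
      h11, Instr.time, Instr.calls]
    exact Or.inr ⟨this, h⟩
  · have h' := (not_le.1 h).le
    have := hX.le_of_active_le hlt hb h'
    simp [block_cons_iff, instr_iff, block_nil_iff, Instr.effect, NatOp.eval, hM.nat3, hM.nat4, h10,
      h11, Instr.time, Instr.calls]
    exact Or.inl ⟨h', this⟩

/-- The invariant of the loop is `IsPartialBalancing` for the vectors `y i = √β'_i Q e_i`. -/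
theorem equalize_spec [NeZero d] [NeZero k] (hM : Ready d k M) {y : Fin d → ℕ → ℝ} {b : ℕ → ℝ}
    {m : ℝ} (hbdef : b = water (min d k) (M.real 4) (M.arr 3 0))
    (hydef : y = fun (r : Fin d) i => √(b i) * M.arr 2 r i)
    (hb : ∀ i j, i ≤ j → j < k → b j ≤ b i)
    (hy : ∀ i < k, ∀ j < k, ∑ r, y r i * y r j = if i = j then b i else 0)
    (h12 : M.nat 12 = 0) (h13 : M.nat 13 = 1) (h20 : M.real 20 = m)
    (hX : IsPartialBalancing y b m k 0 (M.nat 10) (M.nat 11) (fun r c => M.arr 1 r c)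
      (M.real 19)) :
    Total E f .equalize M fun M' T N =>
      ((∀ r r' : Fin d, ∑ c ∈ Finset.range k, M'.arr 1 r c * M'.arr 1 r' c =
        ∑ i ∈ Finset.range k, y r i * y r' i) ∧
      ∀ c < k, ∑ r : Fin d, M'.arr 1 r c ^ 2 = m) ∧ T ≤ 60 * k * d ∧ N = 0 := by
  have hd := NeZero.pos d
  have hk := NeZero.pos k
  unfold Program.equalize
  refine (while_of (fun n M' => n + 1 ≤ k ∧ M'.nat 12 = n ∧ M'.nat 13 = n + 1 ∧
    IsPartialBalancing y b m k n (M'.nat 10) (M'.nat 11) (fun r c => M'.arr 1 r c) (M'.real 19))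
    (k - 1) (50 * d) 0 ⟨hk, h12, h13, hX⟩ ?_).mono ?_
  · rintro n M' hF ⟨hn, h12', h13', hX'⟩ hlt
    have hM' : Ready d k M' := hM.of_frame hF (by decide) (by decide)
    have a4 : M'.real 4 = M.real 4 := hF.real 4 (by decide)
    have a20 : M'.real 20 = m := (hF.real 20 (by decide)).trans h20
    have at2 : M'.arr 2 = M.arr 2 := hF.arr 2 (by decide)
    have at3 : M'.arr 3 = M.arr 3 := hF.arr 3 (by decide)
    simp only [Test.Holds, h13', hM'.nat1] at hlt
    have hlohi : M'.nat 10 < M'.nat 11 := by have := hX'.count; omega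
    refine ⟨by omega, ?_⟩
    rw [block_cons_iff]
    refine (choosePartner_spec hM' rfl rfl hlohi hb (by rw [a20]; exact hX')).mono ?_
    rintro M₁ T₁ N₁ ⟨hF₁, ⟨hq, hm⟩, hT₁, rfl⟩
    have hM₁ : Ready d k M₁ := hM'.of_frame hF₁ (by decide) (by decide)
    rw [block_cons_iff]
    refine (loadWater_spec hM₁).mono ?_
    rintro M₂ T₂ N₂ ⟨hF₂, h17, h18, hT₂, rfl⟩
    have hM₂ : Ready d k M₂ := hM₁.of_frame hF₂ (by decide) (by decide)
    rw [hF₁.real 4 (by decide), hF₁.arr 3 (by decide), a4, at3, ← hbdef] at h17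
    rw [block_cons_iff]
    refine (computeAngle_spec hM₂).mono ?_
    rintro M₃ T₃ N₃ ⟨hF₃, h22, h23, hT₃, rfl⟩
    have hM₃ : Ready d k M₃ := hM₂.of_frame hF₃ (by decide) (by decide)
    rw [hF₂.real 19 (by decide), hF₁.real 19 (by decide), h17, hF₂.real 20 (by decide),
      hF₁.real 20 (by decide)] at h22 h23
    obtain ⟨hw0, hw1, hw⟩ := rotationWeight_spec hm
    set w := rotationWeight (M'.real 19) (b (M₁.nat 9)) (M'.real 20)
    rw [block_cons_iff]
    have e12 : M₃.nat 12 = n := by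
      rw [hF₃.nat 12 (by decide), hF₂.nat 12 (by decide), hF₁.nat 12 (by decide), h12']
    have e13 : M₃.nat 13 = n + 1 := by
      rw [hF₃.nat 13 (by decide), hF₂.nat 13 (by decide), hF₁.nat 13 (by decide), h13']
    refine (rotateColumns_spec hM₃ e12 e13).mono ?_
    rintro M₄ T₄ N₄ ⟨hF₄, ⟨hc0, hc1, hc2⟩, hT₄, rfl⟩
    have hM₄ : Ready d k M₄ := hM₃.of_frame hF₄ (by decide) (by decide)
    have e1 : M₃.arr 1 = M'.arr 1 := by
      rw [hF₃.arr 1 (by decide), hF₂.arr 1 (by decide), hF₁.arr 1 (by decide)]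
    have e2 : M₃.arr 2 = M.arr 2 := by
      rw [hF₃.arr 2 (by decide), hF₂.arr 2 (by decide), hF₁.arr 2 (by decide), at2]
    have e9 : M₃.nat 9 = M₁.nat 9 := by rw [hF₃.nat 9 (by decide), hF₂.nat 9 (by decide)]
    have e18 : M₃.real 18 = √(b (M₁.nat 9)) := by rw [hF₃.real 18 (by decide), h18, h17]
    rw [e1] at hc0
    rw [e1, e2, e9, e18, h22, h23] at hc1 hc2
    have g10 : M₄.nat 10 = M₁.nat 10 := by
      rw [hF₄.nat 10 (by decide), hF₃.nat 10 (by decide), hF₂.nat 10 (by decide)]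
    have g11 : M₄.nat 11 = M₁.nat 11 := by
      rw [hF₄.nat 11 (by decide), hF₃.nat 11 (by decide), hF₂.nat 11 (by decide)]
    have g12 : M₄.nat 12 = n := by rw [hF₄.nat 12 (by decide), e12]
    have g13 : M₄.nat 13 = n + 1 := by rw [hF₄.nat 13 (by decide), e13]
    have g17 : M₄.real 17 = b (M₁.nat 9) := by
      rw [hF₄.real 17 (by decide), hF₃.real 17 (by decide), h17]
    have g19 : M₄.real 19 = M'.real 19 := by
      rw [hF₄.real 19 (by decide), hF₃.real 19 (by decide), hF₂.real 19 (by decide),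
        hF₁.real 19 (by decide)]
    have g20 : M₄.real 20 = m := by
      rw [hF₄.real 20 (by decide), hF₃.real 20 (by decide), hF₂.real 20 (by decide),
        hF₁.real 20 (by decide), a20]
    rw [a20] at hw
    have hstep := hX'.rotate hy hlohi hq (C := √w) (S := √(1 - w))
      (X' := fun r c => M₄.arr 1 r c)
      (by rw [Real.sq_sqrt hw0, Real.sq_sqrt (sub_nonneg.2 hw1)]; ring)
      (by rw [Real.sq_sqrt hw0, Real.sq_sqrt (sub_nonneg.2 hw1)]; exact hw)
      (fun r c hc => hc0 r c hc) (fun r => by rw [hydef]; exact hc1 r r.isLt)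
      (fun r => by rw [hydef]; exact hc2 r r.isLt)
    simp [block_cons_iff, instr_iff, block_nil_iff, Instr.effect, RealOp.eval, NatOp.eval,
      hM₄.nat3, g10, g11, g12, g13, g17, g19, g20, Instr.time, Instr.calls]
    exact ⟨⟨hlt, hstep⟩, by omega⟩
  · rintro M' T N ⟨hF, n, hn, ⟨hnk, h12', h13', hX'⟩, hb', hT, hN⟩
    have a1 : M'.nat 1 = k := (hF.nat 1 (by decide)).trans hM.nat1
    simp only [Test.Holds, h13', a1, not_lt] at hb'
    have hnk' : n + 1 = k := by omega
    have ha := hX'.active_eq hnk'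
    refine ⟨⟨fun r r' => ?_, fun c hc => ?_⟩, ?_, by omega⟩
    · have hlohi : M'.nat 10 = M'.nat 11 := by have := hX'.count; omega
      have := hX'.gram r r'
      rw [hlohi, Finset.Ico_self, Finset.sum_empty, add_zero, hnk'] at this
      exact this
    · rcases Nat.lt_succ_iff_lt_or_eq.1 (hnk' ▸ hc : c < n + 1) with h | rfl
      · exact hX'.col c h
      · exact hX'.active.trans ha
    · have h1 : n * (50 * d + 1) ≤ k * (50 * d + 1) := Nat.mul_le_mul_right _ (by omega)
      have h2 : 1 ≤ k * d := Nat.mul_pos hk hd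
      have h3 : k ≤ k * d := Nat.le_mul_of_pos_right _ hd
      nlinarith
end
section
variable {E : Eigensolver} {d k : ℕ} {f : (Fin d → ℝ) → EReal} {M : Memory}

theorem sum_mul_water (d k : ℕ) (c : ℝ) (τ F : ℕ → ℝ) :
    ∑ j : Fin d, F j * water (min d k) c τ j =
      ∑ i ∈ Finset.range k, F i * water (min d k) c τ i := by
  have h : ∀ n, min d k ≤ n → ∑ i ∈ Finset.range (min d k), F i * water (min d k) c τ i =
      ∑ i ∈ Finset.range n, F i * water (min d k) c τ i := fun n hn =>
    Finset.sum_subset (Finset.range_mono hn) fun i _ hi => by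
      rw [water, if_neg (by simpa using hi), mul_zero]
  rw [Fin.sum_univ_eq_sum_range (fun j => F j * water (min d k) c τ j), ← h d (min_le_left _ _),
    h k (min_le_right _ _)]

theorem factorize_spec [NeZero d] [NeZero k] (hM : Ready d k M) {A Q : Matrix (Fin d) (Fin d) ℝ}
    {t : Fin d → ℝ} (hA : IsEigendecomp A Q t) (hτ : ∀ j : Fin d, t j = M.arr 3 0 j)
    (hQ : ∀ i j : Fin d, Q i j = M.arr 2 i j) {s : ℝ} (h3 : M.real 3 = s) (hs : 0 ≤ s) :
    Total E f .factorize M fun M' T N =>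
      IsBalancedDesign Q t s (M'.block 1 d k) ∧ T ≤ 120 * k * d ∧ N = 0 := by
  have hd := NeZero.pos d
  have hk := NeZero.pos k
  unfold Program.factorize
  rw [block_cons_iff]
  refine (computeLevel_spec hM (one_le_min_neZero d k)).mono ?_
  rintro M₁ T₁ N₁ ⟨hF₁, hc, hT₁, rfl⟩
  have hM₁ : Ready d k M₁ := hM.of_frame hF₁ (by decide) (by decide)
  rw [h3] at hc
  have hlev := hc.level_eq hA.sorted hτ hs
  rw [block_cons_iff]
  refine (initDesign_spec hM₁).mono ?_
  rintro M₂ T₂ N₂ ⟨hF₂, ⟨⟨h10, h11, h12, h13⟩, h19, h20, hcol⟩, hT₂, rfl⟩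
  have hM₂ : Ready d k M₂ := hM₁.of_frame hF₂ (by decide) (by decide)
  have e4 : M₂.real 4 = M₁.real 4 := hF₂.real 4 (by decide)
  have e3 : M₂.arr 3 = M.arr 3 := by rw [hF₂.arr 3 (by decide), hF₁.arr 3 (by decide)]
  have e2 : M₂.arr 2 = M.arr 2 := by rw [hF₂.arr 2 (by decide), hF₁.arr 2 (by decide)]
  rw [hF₁.real 3 (by decide), h3] at h20
  rw [hF₁.arr 3 (by decide)] at h19
  rw [hF₁.arr 3 (by decide), hF₁.arr 2 (by decide)] at hcol
  generalize hcdef : M₁.real 4 = c at *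
  generalize hτdef : M.arr 3 0 = τ at *
  obtain ⟨b, hbdef⟩ : ∃ b, b = water (min d k) c τ := ⟨_, rfl⟩
  obtain ⟨y, hydef⟩ : ∃ y : Fin d → ℕ → ℝ, y = fun (r : Fin d) i => √(b i) * M.arr 2 r i :=
    ⟨_, rfl⟩
  rw [← hbdef] at h19 hcol
  have hb0 : ∀ i, 0 ≤ b i := fun i => hbdef ▸ water_nonneg _ _ _ _
  have hbanti : ∀ i j, i ≤ j → j < k → b j ≤ b i := by
    intro i j hij hj
    rw [hbdef]
    unfold water
    split_ifs with h1 h2 h2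
    · have := hA.sorted (a := ⟨i, by omega⟩) (b := ⟨j, by omega⟩) hij
      simp only [hτ] at this
      exact max_le_max (by linarith) le_rfl
    · omega
    · exact le_max_right _ _
    · exact le_rfl
  have hbz : ∀ i, ¬ i < min d k → b i = 0 := fun i hi => by rw [hbdef, water, if_neg hi]
  have hyy : ∀ i < k, ∀ j < k, ∑ r, y r i * y r j = if i = j then b i else 0 := by
    intro i _ j _
    have h1 : ∀ r, y r i * y r j = √(b i) * √(b j) * (M.arr 2 r i * M.arr 2 r j) :=
      fun r => by rw [hydef]; ring
    simp only [h1, ← Finset.mul_sum]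
    by_cases hi : i < min d k
    · by_cases hj : j < min d k
      · have h2 := congrFun (congrFun hA.orthogonal ⟨i, by omega⟩) ⟨j, by omega⟩
        simp only [mul_apply, transpose_apply, hQ, one_apply, Fin.mk.injEq] at h2
        rw [h2]
        split_ifs with h
        · rw [← h, Real.mul_self_sqrt (hb0 i), mul_one]
        · rw [mul_zero]
      · rw [hbz j hj, if_neg (by omega)]
        simp
    · rw [hbz i hi]
      simp
  have hbsum : ∑ i ∈ Finset.range k, b i = s := by
    have h1 := sum_mul_water d k c τ (fun _ => 1)
    simp only [one_mul, ← hbdef] at h1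
    rw [← h1, ← sum_beta' (k := k) hA.sorted hs, beta'_eq_topFill, hlev]
    exact Finset.sum_congr rfl fun j _ => by rw [hbdef, water, topFill, hτ]
  rw [block_cons_iff]
  refine (equalize_spec hM₂ (y := y) (b := b) (m := s / k) (by rw [e4, e3, hτdef, hbdef])
    (by rw [e2, hydef]) hbanti hyy h12 h13 h20 ?_).mono ?_
  · have hcol' : ∀ r : Fin d, M₂.arr 1 r 0 = y r 0 := fun r => by rw [hcol r r.isLt, hydef]
    rw [h10, h11, h19]
    refine ⟨hk, le_rfl, by omega, fun r r' => ?_, fun c hc => by omega, ?_, fun i hi1 hi2 => ?_, ?_⟩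
    · simp only [zero_add, Finset.sum_range_one, hcol']
      rw [Finset.range_eq_Ico, Finset.sum_eq_sum_Ico_succ_bot hk]
    · simpa only [hcol', sq, if_true] using hyy 0 hk 0 hk
    · simpa only [hcol', if_neg (by omega : ¬ 0 = i)] using hyy 0 hk i hi2
    · rw [← zero_add 1, ← Finset.sum_eq_sum_Ico_succ_bot hk b, ← Finset.range_eq_Ico, hbsum]
      have : (k : ℝ) ≠ 0 := by exact_mod_cast hk.ne'
      field_simp
      simp
  · rintro M₃ T₃ N₃ ⟨⟨hgram, hcols⟩, hT₃, rfl⟩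
    rw [block_nil_iff]
    refine ⟨⟨?_, fun j => hcols j j.isLt⟩, ?_, rfl⟩
    · ext r r'
      rw [mul_apply, mul_apply]
      simp only [mul_diagonal, transpose_apply]
      have h1 := Fin.sum_univ_eq_sum_range (fun c => M₃.arr 1 r c * M₃.arr 1 r' c) k
      have h2 := sum_mul_water d k c τ (fun i => M.arr 2 r i * M.arr 2 r' i)
      refine h1.trans ((hgram r r').trans ?_)
      have h3 : ∀ i, y r i * y r' i = M.arr 2 r i * M.arr 2 r' i * water (min d k) c τ i := by
        intro i
        rw [← hbdef, hydef]
        linear_combination (M.arr 2 r i * M.arr 2 r' i) * Real.mul_self_sqrt (hb0 i)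
      simp only [h3]
      rw [← h2]
      refine Finset.sum_congr rfl fun j _ => ?_
      rw [beta'_eq_topFill, hlev, topFill, water, hQ, hQ, hτ]
      ring
    · have h1 : d ≤ k * d := Nat.le_mul_of_pos_left _ hk
      have h2 : 60 * k * d = 60 * (k * d) := by ring
      have h3 : 120 * k * d = 120 * (k * d) := by ring
      omega

theorem eig_effect {n : ℕ} (h : M.nat 0 = n) :
    Instr.effect E f (.eig 0 0 2 3) M =
      (M.setBlock 2 (E.vecs n (M.block 0 n n))).setBlock 3
        (Matrix.of fun _ : Fin 1 => E.vals n (M.block 0 n n)) := by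
  subst h
  rfl

theorem prepare_spec (h0 : M.nat 0 = d) (h1 : M.nat 1 = k) {A : Matrix (Fin d) (Fin d) ℝ}
    (hA : M.block 0 d d = A) :
    Total E f .prepare M fun M' T N => Frame .prepare M M' ∧
      (Ready d k M' ∧ (∀ j : Fin d, E.vals d A j = M'.arr 3 0 j) ∧
        ∀ i j : Fin d, E.vecs d A i j = M'.arr 2 i j) ∧ T ≤ d ^ 3 + 10 ∧ N = 0 := by
  apply Total.frame
  unfold Program.prepare
  simp only [block_cons_iff, instr_iff]
  refine Total.mono (Q := fun M' T N => (Ready d k M' ∧ M'.block 0 d d = A) ∧ T = 2 ∧ N = 0) ?_ ?_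
  · refine ite_of (fun h => ?_) fun h => ?_
    all_goals
      simp [Test.Holds, Instr.effect, h0, h1] at h
      rw [instr_iff]
      have hmin : min d k = if k < d then k else d := by split_ifs <;> omega
      refine ⟨⟨?_, ?_⟩, rfl, rfl⟩
      · constructor <;> simp [Instr.effect, NatOp.eval, h0, h1, hmin, h]
      · exact hA
  · rintro M' T N ⟨⟨hM', hA'⟩, rfl, rfl⟩
    rw [block_nil_iff, eig_effect hM'.nat0, hA']
    refine ⟨⟨?_, ?_, ?_⟩, ?_, ?_⟩
    · constructor <;>
        simp [Memory.setBlock, hM'.nat0, hM'.nat1, hM'.nat3, hM'.nat4, hM'.nat5, hM'.real2]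
    · intro j
      simp [Memory.setBlock]
    · intro i j
      simp [Memory.setBlock]
    · simp only [Instr.time, hM'.nat0]
      omega
    · rfl

end

/-! ### The objective along the water-filling path -/

section
variable {d k : ℕ} [NeZero d] [NeZero k] {A Q : Matrix (Fin d) (Fin d) ℝ} {t : Fin d → ℝ}

/-- A Schur--Horn theorem: every point of the water-filling path is realized by a design whose
columns are equally long, namely by the one that the program computes. -/
theorem exists_isBalancedDesign (hA : IsEigendecomp A Q t) {s : ℝ} (hs : 0 ≤ s) :
    ∃ X : Matrix (Fin d) (Fin k) ℝ, IsBalancedDesign Q t s X := by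
  obtain ⟨E⟩ := nonempty_eigensolver
  let M : Memory :=
    { nat := fun i => if i = 0 then d else if i = 1 then k else if i = 3 then 1 else
        if i = 5 then min d k else 0
      real := fun i => if i = 3 then s else 0
      arr := fun a i j => if h : i < d ∧ j < d then
        (if a = 2 then Q ⟨i, h.1⟩ ⟨j, h.2⟩ else t ⟨j, h.2⟩) else 0 }
  have hM : Ready d k M := by constructor <;> simp [M]
  obtain ⟨M', T, N, -, h, -⟩ := factorize_spec (E := E) (f := fun _ => 0) hM hA
    (fun j => by simp [M, NeZero.pos d]) (fun i j => by simp [M]) (s := s) (by simp [M]) hs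
  exact ⟨_, h⟩

/-- Hence the objective is finite and Lipschitz along the whole path. -/
theorem add_beta_mem_eigRegion (hA : IsEigendecomp A Q t) {s : ℝ} (hs : s ∈ Set.Icc (0 : ℝ) k) :
    t + beta t k s ∈ eigRegion A k := by
  obtain ⟨X, hX⟩ := exists_isBalancedDesign (k := k) hA hs.1
  exact ⟨X, hX.feasible hs.2, (infoEigs_eq_add_beta hA hX.gram).symm⟩

variable {f : (Fin d → ℝ) → EReal} {L : ℝ}

theorem coe_toReal_beta (hf : IsSymmConvex f) (hL : LipschitzOnRegion f L (eigRegion A k))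
    (hA : IsEigendecomp A Q t) {s : ℝ} (hs : s ∈ Set.Icc (0 : ℝ) k) :
    ((f (t + beta t k s)).toReal : EReal) = f (t + beta t k s) :=
  EReal.coe_toReal (hL.1 _ (add_beta_mem_eigRegion hA hs)) (hf.ne_bot _)

theorem convexOn_beta (hf : IsSymmConvex f) (hL : LipschitzOnRegion f L (eigRegion A k))
    (hA : IsEigendecomp A Q t) :
    ConvexOn ℝ (Set.Icc 0 (k : ℝ)) fun s => (f (t + beta t k s)).toReal := by
  rw [convexOn_iff_forall_pos]
  refine ⟨convex_Icc _ _, fun s hs s' hs' a b ha hb hab => ?_⟩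
  have h := hf.beta_convex (k := k) hA.sorted hs.1 hs'.1 ha hb hab
  have hc : a * s + b * s' ∈ Set.Icc (0 : ℝ) k := convex_Icc _ _ hs hs' ha.le hb.le hab
  rw [← coe_toReal_beta hf hL hA hs, ← coe_toReal_beta hf hL hA hs',
    ← coe_toReal_beta hf hL hA hc] at h
  exact_mod_cast h

theorem abs_sub_beta_le (hL0 : 0 ≤ L) (hL : LipschitzOnRegion f L (eigRegion A k))
    (hA : IsEigendecomp A Q t) : ∀ s ∈ Set.Icc (0 : ℝ) k, ∀ s' ∈ Set.Icc (0 : ℝ) k,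
      |(f (t + beta t k s)).toReal - (f (t + beta t k s')).toReal| ≤ L * |s - s'| := by
  intro s hs s' hs'
  refine (hL.2 _ (add_beta_mem_eigRegion hA hs) _ (add_beta_mem_eigRegion hA hs')).trans ?_
  rw [add_sub_add_left_eq_sub]
  exact mul_le_mul_of_nonneg_left (norm_beta_sub_le hA.sorted hs.1 hs'.1) hL0

end

/-! ### The whole program -/

section
variable {E : Eigensolver} {d k : ℕ} {f : (Fin d → ℝ) → EReal} {M : Memory}

/-- If the middle step yields a budget with the property `P`, then the result is a factorization
for such a budget. -/
theorem solve_spec [NeZero d] [NeZero k] (h0 : M.nat 0 = d) (h1 : M.nat 1 = k)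
    {A : Matrix (Fin d) (Fin d) ℝ} (hsymm : A.IsSymm) (hA : M.block 0 d d = A)
    {P : ℝ → Prop} (hP : ∀ s, P s → 0 ≤ s) {T₀ N₀ : ℕ}
    (hbud : ∀ M', Frame .prepare M M' → Ready d k M' →
      (∀ j : Fin d, E.vals d A j = M'.arr 3 0 j) →
      Total E f (.ite (.natLt 4 2) (.instr (.ofNat 3 1)) .search) M' fun M'' T N =>
        P (M''.real 3) ∧ T ≤ T₀ ∧ N ≤ N₀) :
    Total E f .solve M fun M' T N =>
      (∃ s, P s ∧ IsBalancedDesign (E.vecs d A) (E.vals d A) s (M'.block 1 d k)) ∧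
      T ≤ d ^ 3 + 120 * k * d + T₀ + 11 ∧ N ≤ N₀ := by
  unfold Program.solve
  rw [block_cons_iff]
  refine (prepare_spec h0 h1 hA).mono ?_
  rintro M₁ T₁ N₁ ⟨hF₁, ⟨hM₁, hτ, hQ⟩, hT₁, rfl⟩
  rw [block_cons_iff]
  refine (hbud M₁ hF₁ hM₁ hτ).frame.mono ?_
  rintro M₂ T₂ N₂ ⟨hF₂, hs, hT₂, hN₂⟩
  have hM₂ : Ready d k M₂ := hM₁.of_frame hF₂ (by decide) (by decide)
  rw [← hF₂.arr 3 (by decide)] at hτ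
  rw [← hF₂.arr 2 (by decide)] at hQ
  rw [block_cons_iff]
  refine (factorize_spec hM₂ (E.spec d A hsymm) hτ hQ rfl (hP _ hs)).mono ?_
  rintro M₃ T₃ N₃ ⟨hX, hT₃, rfl⟩
  rw [block_nil_iff]
  exact ⟨⟨_, hs, hX⟩, by omega, by omega⟩

theorem block_inputMemory (A : Matrix (Fin d) (Fin d) ℝ) (mono : Bool) (L ε : ℝ) :
    (inputMemory k A mono L ε).block 0 d d = A := by
  ext i j
  simp [inputMemory, Memory.block]

/-- Whether the solution is computed from the cleared input or from the original input, its result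
is returned. -/
theorem returns_of_solve {A : Matrix (Fin d) (Fin d) ℝ} {mono : Bool} {L ε : ℝ} {M' : Memory}
    {T N : ℕ} (h : Exec E f .solve (inputMemory k A mono (if mono then 0 else L)
      (if mono then 0 else ε)) M' T N) :
    ∃ T' ≤ T + 5, Returns E .spectralDesign A mono f L ε (M'.block 1 d k) T' N := by
  have hmain : Total E f .spectralDesign (inputMemory k A mono L ε) fun M'' T' N' =>
      M''.block 1 d k = M'.block 1 d k ∧ T' ≤ T + 5 ∧ N' = N := by
    unfold Program.spectralDesign
    rw [block_cons_iff]
    refine Total.mono (Q := fun M₁ T₁ N₁ => M₁ = inputMemory k A mono (if mono then 0 else L)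
      (if mono then 0 else ε) ∧ T₁ ≤ 4 ∧ N₁ = 0) ?_ ?_
    · refine ite_of (fun hb => ?_) fun hb => ?_
      all_goals
        cases mono <;> simp [Test.Holds, inputMemory] at hb
        simp [block_cons_iff, block_nil_iff, instr_iff, Instr.effect, Instr.time, Instr.calls,
          inputMemory]
      funext i
      by_cases h0 : i = 0 <;> by_cases h1 : i = 1 <;> simp [h0, h1]
    · rintro _ T₁ _ ⟨rfl, hT₁, rfl⟩
      rw [block_cons_iff]
      exact ⟨M', T, N, h, block_nil_iff.2 ⟨rfl, by omega, by omega⟩⟩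
  obtain ⟨M'', T', _, hE, hM, hT, rfl⟩ := hmain
  exact ⟨T', hT, M'', hE, hM⟩

end

end SpectralDesign

open SpectralDesign SpectralDesign.Total

theorem theorem1 :
    ∃ (P : SpectralDesign.Program) (C : ℝ),
      ∀ (E : SpectralDesign.Eigensolver) (d k : ℕ) [NeZero d] [NeZero k]
        (A : Matrix (Fin d) (Fin d) ℝ), A.PosSemidef →
        -- non-increasing objectives
        ((∀ f : (Fin d → ℝ) → EReal, SpectralDesign.IsSymmConvex f → Antitone f →
            ∀ (ε : ℝ) (X : Matrix (Fin d) (Fin k) ℝ),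
              SpectralDesign.IsAlgorithmOutput A true f ε X → SpectralDesign.IsOptimal A f X) ∧
          ∃ X : Matrix (Fin d) (Fin k) ℝ,
            ∀ f : (Fin d → ℝ) → EReal, SpectralDesign.IsSymmConvex f → Antitone f →
              SpectralDesign.IsOptimal A f X ∧
              ∀ L ε : ℝ, SpectralDesign.IsAlgorithmOutput A true f ε X ∧
                ∃ T : ℕ, SpectralDesign.Returns E P A true f L ε X T 0 ∧
                  (T : ℝ) ≤ C * ((d : ℝ) ^ 3 + k * d)) ∧
        -- Lipschitz objectives
        ∀ f : (Fin d → ℝ) → EReal, SpectralDesign.IsSymmConvex f →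
          ∀ L : ℝ, 0 < L →
            SpectralDesign.LipschitzOnRegion f L (SpectralDesign.eigRegion A k) →
            ∀ ε : ℝ, 0 < ε → ∀ mono : Bool, (mono = true → Antitone f) →
              (∀ X : Matrix (Fin d) (Fin k) ℝ,
                SpectralDesign.IsAlgorithmOutput A mono f ε X →
                  SpectralDesign.IsEpsOptimal A f ε X) ∧
              ∃ (X : Matrix (Fin d) (Fin k) ℝ) (T N : ℕ),
                SpectralDesign.IsAlgorithmOutput A mono f ε X ∧
                SpectralDesign.IsEpsOptimal A f ε X ∧
                SpectralDesign.Returns E P A mono f L ε X T N ∧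
                (N : ℝ) ≤ C * max 0 (Real.log (k * L / ε)) ∧
                (T : ℝ) ≤ C * ((d : ℝ) ^ 3 + k * d + d * max 0 (Real.log (k * L / ε))) := by
  -- generous constants: the factorization takes at most `120 k d` steps, and each step of the
  -- search at most `150 d`
  refine ⟨.spectralDesign, 500 + 150 * searchConst, fun E d k _ _ A hApsd => ?_⟩
  have hd : (1 : ℝ) ≤ d := by exact_mod_cast NeZero.pos d
  have hk : (1 : ℝ) ≤ k := by exact_mod_cast NeZero.pos k
  have hkd : (1 : ℝ) ≤ k * d := one_le_mul_of_one_le_of_one_le hk hd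
  have hdkd : (d : ℝ) ≤ k * d := le_mul_of_one_le_left (by linarith) hk
  have hc := searchConst_pos
  have hsymm : A.IsSymm := by
    have := hApsd.isHermitian
    rwa [Matrix.IsHermitian, Matrix.conjTranspose_eq_transpose_of_trivial] at this
  have hA := E.spec d A hsymm
  -- The design for all non-increasing objectives is the result for the objective `0`, as no oracle
  -- call is made.
  obtain ⟨M₀, T₀, N₀, hexec, ⟨s₀, rfl, hX₀⟩, hT₀, hN₀⟩ :=
    solve_spec (E := E) (f := fun _ : Fin d → ℝ => 0) (M := inputMemory k A true 0 0)
      (k := k) (by simp [inputMemory]) (by simp [inputMemory]) hsymm (block_inputMemory A true 0 0)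
      (P := fun s => s = k) (by rintro _ rfl; positivity) (T₀ := 2) (N₀ := 0)
      (fun M' hF hM' _ => by
        refine ite_of (fun _ => ?_) fun hb => ?_
        · rw [instr_iff]
          simp [Instr.effect, hM'.nat1, Instr.time, Instr.calls]
        · have h2 : M'.nat 2 = 1 := (hF.nat 2 (by decide)).trans (by simp [inputMemory])
          simp [Test.Holds, h2, hM'.nat4] at hb)
  obtain rfl : N₀ = 0 := Nat.le_zero.1 hN₀
  have hout : ∀ (f : (Fin d → ℝ) → EReal) (ε : ℝ),
      IsAlgorithmOutput A true f ε (M₀.block 1 d k) := fun f ε =>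
    isAlgorithmOutput_iff.2 ⟨_, _, _, hA, by simp [IsBudget], hX₀⟩
  have hret : ∀ (f : (Fin d → ℝ) → EReal) (L ε : ℝ),
      ∃ T' ≤ T₀ + 5, Returns E .spectralDesign A true f L ε (M₀.block 1 d k) T' 0 := fun f L ε =>
    returns_of_solve (by simpa using hexec.of_calls_eq_zero rfl f)
  have htime : ∀ T' ≤ T₀ + 5, (T' : ℝ) ≤ (500 + 150 * searchConst) * ((d : ℝ) ^ 3 + k * d) := by
    intro T' hT'
    have hT'' : (T' : ℝ) ≤ T₀ + 5 := by exact_mod_cast hT'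
    have : ((T₀ : ℕ) : ℝ) ≤ d ^ 3 + 120 * k * d + 2 + 11 := by exact_mod_cast hT₀
    have h3 : (0 : ℝ) ≤ d ^ 3 := by positivity
    nlinarith [mul_nonneg hc.le h3, mul_nonneg hc.le (by linarith : (0 : ℝ) ≤ k * d)]
  refine ⟨⟨fun f hf hanti ε X hX => isOptimal_of_isAlgorithmOutput hf hanti hX,
    M₀.block 1 d k, fun f hf hanti => ⟨isOptimal_of_isAlgorithmOutput hf hanti (hout f 0),
      fun L ε => ⟨hout f ε, (hret f L ε).imp fun T' h => ⟨h.2, htime T' h.1⟩⟩⟩⟩, ?_⟩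
  intro f hf L hL0 hL ε hε mono hmono
  refine ⟨fun X hX => isEpsOptimal_of_isAlgorithmOutput hf hε.le hmono hX, ?_⟩
  have hlog : 0 ≤ max 0 (Real.log (k * L / ε)) := le_max_left _ _
  cases mono with
  | true =>
    obtain ⟨T', hT', hr⟩ := hret f L ε
    refine ⟨_, T', 0, hout f ε, isEpsOptimal_of_isAlgorithmOutput hf hε.le hmono (hout f ε), hr,
      by rw [Nat.cast_zero]; positivity, (htime T' hT').trans ?_⟩
    exact mul_le_mul_of_nonneg_left (le_add_of_nonneg_right (by positivity)) (by positivity)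
  | false =>
    obtain ⟨M₁, T₁, N₁, hexec₁, ⟨s, hs, hX⟩, hT₁, hN₁⟩ :=
      solve_spec (E := E) (f := f) (M := inputMemory k A false L ε)
        (k := k) (by simp [inputMemory]) (by simp [inputMemory]) hsymm
        (block_inputMemory A false L ε)
        (P := fun s => s ∈ Set.Icc (0 : ℝ) k ∧ ∀ s' ∈ Set.Icc (0 : ℝ) k,
          (f (E.vals d A + beta (E.vals d A) k s)).toReal ≤
            (f (E.vals d A + beta (E.vals d A) k s')).toReal + ε) (fun s hs => hs.1.1)
        (T₀ := 150 * d * (searchSteps (k * L / ε) + 1) + 1)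
        (N₀ := searchSteps (k * L / ε) * 2)
        (fun M' hF hM' hτ => by
          refine ite_of (fun hb => ?_) fun _ => ?_
          · have h2 : M'.nat 2 = 0 := (hF.nat 2 (by decide)).trans (by simp [inputMemory])
            simp [Test.Holds, h2] at hb
          · refine (search_spec hM' hA.sorted hτ (L := L) (ε := ε)
              ((hF.real 0 (by decide)).trans (by simp [inputMemory]))
              ((hF.real 1 (by decide)).trans (by simp [inputMemory])) hL0 hε rfl
              (convexOn_beta hf hL hA) (abs_sub_beta_le hL0.le hL hA)).mono ?_
            rintro M'' T N ⟨-, h, hT, hN⟩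
            exact ⟨h, by omega, hN⟩)
    have hout₁ : IsAlgorithmOutput A false f ε (M₁.block 1 d k) := by
      refine isAlgorithmOutput_iff.2 ⟨_, _, s, hA, ?_, hX⟩
      simp only [IsBudget, Bool.false_eq_true, if_false]
      refine ⟨hs.1, fun s' hs' => ?_⟩
      rw [← coe_toReal_beta hf hL hA hs.1, ← coe_toReal_beta hf hL hA hs']
      exact_mod_cast hs.2 s' hs'
    have hK := searchSteps_le (k * L / ε)
    generalize searchSteps (k * L / ε) = K at *
    generalize max 0 (Real.log (k * L / ε)) = l at *
    obtain ⟨T', hT', hr⟩ := returns_of_solve (mono := false) (L := L) (ε := ε)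
      (by simpa using hexec₁)
    refine ⟨_, T', N₁, hout₁, isEpsOptimal_of_isAlgorithmOutput hf hε.le hmono hout₁, hr, ?_, ?_⟩
    · have : (N₁ : ℝ) ≤ K * 2 := by exact_mod_cast hN₁
      nlinarith [mul_nonneg hc.le hlog]
    · have : (T₁ : ℝ) ≤ d ^ 3 + 120 * k * d + (150 * d * (K + 1) + 1) + 11 := by
        exact_mod_cast hT₁
      have hT'' : (T' : ℝ) ≤ T₁ + 5 := by exact_mod_cast hT'
      have h1 : (d : ℝ) * K ≤ d * (searchConst * l) := mul_le_mul_of_nonneg_left hK (by linarith)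
      have h2 : (0 : ℝ) ≤ d ^ 3 := by positivity
      have h3 := mul_nonneg hc.le h2
      have h4 := mul_nonneg hc.le (by linarith : (0 : ℝ) ≤ k * d)
      have h5 : 0 ≤ d * l := mul_nonneg (by linarith) hlog
      nlinarith
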